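/- Let $k$ be a commutative ring and $A$ a commutative $k$-algebra. **Notation.** Let $I=\ker(A\otimes_kA\to A)$ be the kernel of the multiplication, with $A\otimes_kA$ an $A$-algebra through the left factor, let $\Omega_{A/k}=I/I^2$ with $dx$ the class of $1\otimes x-x\otimes 1$, and let $\operatorname{gr}_I(A\otimes_kA)=\bigoplus_{n\ge0}I^n/I^{n+1}$. Let $$\upsilon:\operatorname{Sym}_A\Omega_{A/k}\longrightarrow \operatorname{gr}_I(A\otimes_kA)$$ be the homomorphism of graded $A$-algebras which is the identity of $I/I^2$ in degree one. For $\varphi\in\operatorname{End}_k(A)$ and $a\in A$ put $[\varphi,a]=\varphi a-a\varphi$. Let $\operatorname{Diff}^{(n)}\subset\operatorname{End}_k(A)$ be the $A$-module of differential operators of order $\le n$: $\operatorname{Diff}^{(-1)}=0$, and $\varphi\in\operatorname{Diff}^{(n)}$ if and only if $[\varphi,a]\in\operatorname{Diff}^{(n-1)}$ for all $a\in A$. Let $\operatorname{gr}\operatorname{Diff}_{A/k}=\bigoplus_{n\ge0}\operatorname{Diff}^{(n)}/\operatorname{Diff}^{(n-1)}$, a commutative graded $A$-algebra, and let $\sigma_n(P)$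 be the class of $P\in\operatorname{Diff}^{(n)}$ in degree $n$. Let $(\operatorname{Sym}\Omega_{A/k})^*_{\mathrm{gr}}=\bigoplus_{n\ge0}\operatorname{Hom}_A(\operatorname{Sym}^n_A\Omega_{A/k},A)$ be the graded dual, with the shuffle product, i.e. the transpose of the comultiplication of $\operatorname{Sym}_A\Omega_{A/k}$ for which the elements of degree one are primitive. Let $$\theta_{A/k}:\operatorname{gr}\operatorname{Diff}_{A/k}\longrightarrow(\operatorname{Sym}\Omega_{A/k})^*_{\mathrm{gr}}$$ be the homomorphism of graded $A$-algebras with $$\theta_{A/k}(\sigma_n(P))(dx_1\cdots dx_n)=[\cdots[[P,x_n],x_{n-1}],\dots,x_1](1)\qquad(P\in\operatorname{Diff}^{(n)},\ x_i\in A).$$ A Hasse–Schmidt derivation of $A$ over $k$ (of infinite length) is a sequence $D=(D_n)_{n\ge0}$ in $\operatorname{End}_k(A)$ with $D_0=\mathrm{id}$ and $D_n(xy)=\sum_{i+j=n}D_i(x)D_j(y)$ for all $n$, $x$, $y$. Let $\operatorname{Ider}_k(A)\subset\operatorname{Der}_k(A)$ be the $A$-submodule of integrable derivations, i.e. of those $\delta$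 with $\delta=D_1$ for some such $D$. Let $\Gamma_A$ denote the divided power algebra, with divided powers $\gamma_n$, and let $$\vartheta:\Gamma_A\operatorname{Ider}_k(A)\longrightarrow\operatorname{gr}\operatorname{Diff}_{A/k}$$ be the homomorphism of graded $A$-algebras with $\vartheta(\gamma_n(\delta))=\sigma_n(D_n)$ for every $n\ge 0$ and every Hasse–Schmidt derivation $D$ with $D_1=\delta$. **Corollary.** Assume that $\Omega_{A/k}$ is a projective $A$-module of finite rank (i.e. finitely generated and projective) and that $A$ is differentially smooth over $k$, i.e. that $\upsilon$ is an isomorphism. Then: (a) $\theta_{A/k}$ is an isomorphism of graded $A$-algebras; (b) $\vartheta$ is an isomorphism of graded $A$-algebras; (c) $\operatorname{Ider}_k(A)=\operatorname{Der}_k(A)$. -/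

import Mathlib

noncomputable section

open scoped TensorProduct DirectSum

namespace DiffSmooth

/-! ### The associated graded algebra of a filtration -/

section AssocGraded

variable {A S : Type*} [CommRing A] [Ring S] [Module A S]

/-- The `n`-th graded piece `F n / G n`; here `G n` is the part of the filtration `F` that follows
`F n` (so `G n = F (n + 1)` for a decreasing and `G n = F (n - 1)` for an increasing filtration). -/
def GrPiece (F G : ℕ → Submodule A S) (n : ℕ) : Type _ := ↥(F n) ⧸ (G n).submoduleOf (F n)

variable (F G : ℕ → Submodule A S)

instance (n : ℕ) : AddCommGroup (GrPiece F G n) :=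
  inferInstanceAs (AddCommGroup (↥(F n) ⧸ (G n).submoduleOf (F n)))

instance (n : ℕ) : Module A (GrPiece F G n) :=
  inferInstanceAs (Module A (↥(F n) ⧸ (G n).submoduleOf (F n)))

/-- The class in `F n / G n` of an element of `F n`. -/
def grMk (n : ℕ) : ↥(F n) →ₗ[A] GrPiece F G n := ((G n).submoduleOf (F n)).mkQ

variable {F G}

theorem grMk_surjective (n : ℕ) : Function.Surjective (grMk F G n) :=
  Submodule.mkQ_surjective _

theorem grMk_eq_zero {n : ℕ} {x : ↥(F n)} : grMk F G n x = 0 ↔ (x : S) ∈ G n :=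
  (Submodule.Quotient.mk_eq_zero _).trans Iff.rfl

theorem grMk_eq_iff {n : ℕ} {x y : ↥(F n)} : grMk F G n x = grMk F G n y ↔ (x : S) - y ∈ G n := by
  rw [← sub_eq_zero, ← map_sub, grMk_eq_zero]; rfl

theorem grMk_mk_eq {m n : ℕ} (h : m = n) {x : ↥(F m)} {y : ↥(F n)} (hxy : (x : S) - y ∈ G n) :
    GradedMonoid.mk m (grMk F G m x) = GradedMonoid.mk n (grMk F G n y) := by
  subst h
  rw [grMk_eq_iff.2 hxy]

/-- The linear map out of `F n / G n` induced by a linear map on `F n` that vanishes on `G n`. -/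
def grLift {N : Type*} [AddCommGroup N] [Module A N] (n : ℕ) (f : ↥(F n) →ₗ[A] N)
    (hf : ∀ x : ↥(F n), (x : S) ∈ G n → f x = 0) : GrPiece F G n →ₗ[A] N :=
  ((G n).submoduleOf (F n)).liftQ f fun x hx => hf x hx

@[simp]
theorem grLift_grMk {N : Type*} [AddCommGroup N] [Module A N] (n : ℕ) (f : ↥(F n) →ₗ[A] N)
    (hf : ∀ x : ↥(F n), (x : S) ∈ G n → f x = 0) (x : ↥(F n)) :
    grLift n f hf (grMk F G n x) = f x := rfl

/-- The conditions under which the product of `S` induces a commutative product on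
`⨁ n, F n / G n`. -/
class IsGrCommutative (F G : ℕ → Submodule A S) : Prop where
  one_mem : (1 : S) ∈ F 0
  mul_mem : ∀ {i j : ℕ} {x y : S}, x ∈ F i → y ∈ F j → x * y ∈ F (i + j)
  mul_mem_left : ∀ {i j : ℕ} {x y : S}, x ∈ G i → y ∈ F j → x * y ∈ G (i + j)
  mul_mem_right : ∀ {i j : ℕ} {x y : S}, x ∈ F i → y ∈ G j → x * y ∈ G (i + j)
  comm_mem : ∀ {i j : ℕ} {x y : S}, x ∈ F i → y ∈ F j → x * y - y * x ∈ G (i + j)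

variable [IsGrCommutative F G]

/-- The product `F i / G i × F j / G j → F (i + j) / G (i + j)` induced by the product of `S`. -/
def grMul {i j : ℕ} (x : GrPiece F G i) (y : GrPiece F G j) : GrPiece F G (i + j) :=
  Quotient.liftOn₂' x y
    (fun a b => grMk F G (i + j) ⟨a * b, IsGrCommutative.mul_mem (G := G) a.2 b.2⟩) <| by
    intro a b a' b' ha hb
    have ha : (a : S) - a' ∈ G i := (Submodule.quotientRel_def ((G i).submoduleOf (F i))).1 ha
    have hb : (b : S) - b' ∈ G j := (Submodule.quotientRel_def ((G j).submoduleOf (F j))).1 hb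
    refine grMk_eq_iff.2 ?_
    have : (a : S) * b - a' * b' = (a - a') * b + a' * (b - b') := by noncomm_ring
    simp only [this]
    exact add_mem (IsGrCommutative.mul_mem_left ha b.2) (IsGrCommutative.mul_mem_right a'.2 hb)

theorem grMul_grMk {i j : ℕ} (x : ↥(F i)) (y : ↥(F j)) :
    grMul (grMk F G i x) (grMk F G j y) =
      grMk F G (i + j) ⟨x * y, IsGrCommutative.mul_mem (G := G) x.2 y.2⟩ := rfl

instance : GradedMonoid.GMul (GrPiece F G) := ⟨grMul⟩

instance : GradedMonoid.GOne (GrPiece F G) := ⟨grMk F G 0 ⟨1, IsGrCommutative.one_mem (G := G)⟩⟩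

theorem grMul_add {i j : ℕ} (x : GrPiece F G i) (y z : GrPiece F G j) :
    grMul x (y + z) = grMul x y + grMul x z := by
  obtain ⟨x, rfl⟩ := grMk_surjective _ x
  obtain ⟨y, rfl⟩ := grMk_surjective _ y
  obtain ⟨z, rfl⟩ := grMk_surjective _ z
  rw [← map_add]
  simp only [grMul_grMk]
  rw [← map_add]
  congr 1
  exact Subtype.ext (mul_add _ _ _)

theorem add_grMul {i j : ℕ} (x y : GrPiece F G i) (z : GrPiece F G j) :
    grMul (x + y) z = grMul x z + grMul y z := by
  obtain ⟨x, rfl⟩ := grMk_surjective _ x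
  obtain ⟨y, rfl⟩ := grMk_surjective _ y
  obtain ⟨z, rfl⟩ := grMk_surjective _ z
  rw [← map_add]
  simp only [grMul_grMk]
  rw [← map_add]
  congr 1
  exact Subtype.ext (add_mul _ _ _)

instance : GradedMonoid.GCommMonoid (GrPiece F G) where
  one_mul := by
    rintro ⟨i, x⟩
    obtain ⟨x, rfl⟩ := grMk_surjective _ x
    exact grMk_mk_eq (zero_add i) (by simp)
  mul_one := by
    rintro ⟨i, x⟩
    obtain ⟨x, rfl⟩ := grMk_surjective _ x
    exact grMk_mk_eq (add_zero i) (by simp)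
  mul_assoc := by
    rintro ⟨i, x⟩ ⟨j, y⟩ ⟨l, z⟩
    obtain ⟨x, rfl⟩ := grMk_surjective _ x
    obtain ⟨y, rfl⟩ := grMk_surjective _ y
    obtain ⟨z, rfl⟩ := grMk_surjective _ z
    exact grMk_mk_eq (add_assoc i j l) (by simp [mul_assoc])
  mul_comm := by
    rintro ⟨i, x⟩ ⟨j, y⟩
    obtain ⟨x, rfl⟩ := grMk_surjective _ x
    obtain ⟨y, rfl⟩ := grMk_surjective _ y
    exact grMk_mk_eq (add_comm i j)
      (by simpa [add_comm j i] using IsGrCommutative.comm_mem (G := G) x.2 y.2)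

instance : DirectSum.GCommRing (GrPiece F G) where
  __ := (inferInstance : GradedMonoid.GCommMonoid (GrPiece F G))
  mul_zero {i j} x := by
    have h := grMul_add x (0 : GrPiece F G j) 0
    rw [add_zero] at h
    exact left_eq_add.1 h
  zero_mul {i j} x := by
    have h := add_grMul (0 : GrPiece F G i) 0 x
    rw [add_zero] at h
    exact left_eq_add.1 h
  mul_add := grMul_add
  add_mul := add_grMul
  natCast n := n • GradedMonoid.GOne.one
  natCast_zero := zero_smul _ _
  natCast_succ n := succ_nsmul _ _
  intCast n := n • GradedMonoid.GOne.one
  intCast_ofNat n := natCast_zsmul _ _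
  intCast_negSucc_ofNat n := negSucc_zsmul _ _

/-- `A` acts on `F n / G n` as it acts on `S`. -/
instance [IsScalarTower A S S] : DirectSum.GAlgebra A (GrPiece F G) where
  toFun := ((grMk F G 0).comp
    (LinearMap.toSpanSingleton A ↥(F 0) ⟨1, IsGrCommutative.one_mem (G := G)⟩)).toAddMonoidHom
  map_one := congrArg (grMk F G 0) (one_smul _ _)
  map_mul r s := grMk_mk_eq (zero_add 0).symm (by simp [mul_smul])
  commutes r x := mul_comm _ _
  smul_def := by
    rintro r ⟨i, x⟩
    obtain ⟨x, rfl⟩ := grMk_surjective _ x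
    exact grMk_mk_eq (x := r • x) (zero_add i).symm (by simp)

end AssocGraded

/-! ### Differential operators -/

section DiffOp

variable (k A : Type*) [CommRing k] [CommRing A] [Algebra k A]

variable {k A} in
/-- The commutator `[φ, a] = φ a - a φ` of a `k`-linear map and an element of `A`. -/
def bracket (a : A) : Module.End k A →ₗ[A] Module.End k A where
  toFun φ := φ ∘ₗ LinearMap.mulLeft k a - a • φ
  map_add' φ ψ := by ext x; simp; ring
  map_smul' b φ := by ext x; simp; ring

variable {k A} in
@[simp]
theorem bracket_apply (a : A) (φ : Module.End k A) (x : A) :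
    bracket a φ x = φ (a * x) - a * φ x := rfl

/-- The `k`-linear differential operators `A → A` of order at most `n`. -/
def diffOp : ℕ → Submodule A (Module.End k A)
  | 0 =>
    { carrier := {φ | ∀ a x : A, φ (a * x) = a * φ x}
      add_mem' := fun hφ hψ a x => by simp [hφ a x, hψ a x, mul_add]
      zero_mem' := fun a x => by simp
      smul_mem' := fun b φ hφ a x => by simp [hφ a x]; ring }
  | n + 1 => ⨅ a : A, (diffOp n).comap (bracket a)

/-- The differential operators of order strictly less than `n`. -/
def diffOpLT : ℕ → Submodule A (Module.End k A)
  | 0 => ⊥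
  | n + 1 => diffOp k A n

variable {k A}

theorem mem_diffOp_zero {φ : Module.End k A} :
    φ ∈ diffOp k A 0 ↔ ∀ a x : A, φ (a * x) = a * φ x := Iff.rfl

theorem mem_diffOp_succ {n : ℕ} {φ : Module.End k A} :
    φ ∈ diffOp k A (n + 1) ↔ ∀ a : A, bracket a φ ∈ diffOp k A n := by
  simp [diffOp]

theorem mem_diffOp_iff {n : ℕ} {φ : Module.End k A} :
    φ ∈ diffOp k A n ↔ ∀ a : A, bracket a φ ∈ diffOpLT k A n := by
  cases n with
  | zero =>
    rw [mem_diffOp_zero]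
    refine forall_congr' fun a => ?_
    simp [diffOpLT, LinearMap.ext_iff, sub_eq_zero]
  | succ n => exact mem_diffOp_succ

theorem diffOpLT_le (n : ℕ) : diffOpLT k A n ≤ diffOp k A n := by
  induction n with
  | zero => exact bot_le
  | succ n ih =>
    intro φ hφ
    exact mem_diffOp_succ.2 fun a => ih (mem_diffOp_iff.1 hφ a)

theorem bracket_mul (a : A) (φ ψ : Module.End k A) :
    bracket a (φ * ψ) = bracket a φ * ψ + φ * bracket a ψ := by
  ext x; simp

theorem mul_mem_diffOp {i j : ℕ} {φ ψ : Module.End k A} (hφ : φ ∈ diffOp k A i)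
    (hψ : ψ ∈ diffOp k A j) : φ * ψ ∈ diffOp k A (i + j) := by
  induction hn : i + j generalizing i j φ ψ with
  | zero =>
    obtain ⟨rfl, rfl⟩ : i = 0 ∧ j = 0 := by omega
    intro a x
    simp [mem_diffOp_zero.1 hψ a x, mem_diffOp_zero.1 hφ a (ψ x)]
  | succ n ih =>
    refine mem_diffOp_succ.2 fun a => ?_
    rw [bracket_mul]
    refine add_mem ?_ ?_
    · rcases i with _ | i
      · have h : bracket a φ = 0 := mem_diffOp_iff.1 hφ a
        rw [h, zero_mul]; exact zero_mem _
      · exact ih (mem_diffOp_succ.1 hφ a) hψ (by omega)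
    · rcases j with _ | j
      · have h : bracket a ψ = 0 := mem_diffOp_iff.1 hψ a
        rw [h, mul_zero]; exact zero_mem _
      · exact ih hφ (mem_diffOp_succ.1 hψ a) (by omega)

theorem comm_mem_diffOpLT {i j : ℕ} {φ ψ : Module.End k A} (hφ : φ ∈ diffOp k A i)
    (hψ : ψ ∈ diffOp k A j) : φ * ψ - ψ * φ ∈ diffOpLT k A (i + j) := by
  induction hn : i + j generalizing i j φ ψ with
  | zero =>
    obtain ⟨rfl, rfl⟩ : i = 0 ∧ j = 0 := by omega
    have h1 : ∀ x, φ x = x * φ 1 := fun x => by simpa using mem_diffOp_zero.1 hφ x 1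
    have h2 : ∀ x, ψ x = x * ψ 1 := fun x => by simpa using mem_diffOp_zero.1 hψ x 1
    refine (Submodule.mem_bot A).2 ?_
    ext x
    simp only [LinearMap.sub_apply, Module.End.mul_apply, LinearMap.zero_apply]
    rw [h1 (ψ x), h2 (φ x), h1 x, h2 x]
    ring
  | succ n ih =>
    refine mem_diffOp_iff.2 fun a => ?_
    have h : bracket a (φ * ψ - ψ * φ) =
        (bracket a φ * ψ - ψ * bracket a φ) + (φ * bracket a ψ - bracket a ψ * φ) := by
      rw [map_sub, bracket_mul, bracket_mul]; abel
    rw [h]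
    refine add_mem ?_ ?_
    · rcases i with _ | i
      · have h : bracket a φ = 0 := mem_diffOp_iff.1 hφ a
        rw [h, zero_mul, mul_zero, sub_zero]; exact zero_mem _
      · exact ih (mem_diffOp_succ.1 hφ a) hψ (by omega)
    · rcases j with _ | j
      · have h : bracket a ψ = 0 := mem_diffOp_iff.1 hψ a
        rw [h, zero_mul, mul_zero, sub_zero]; exact zero_mem _
      · exact ih hφ (mem_diffOp_succ.1 hψ a) (by omega)

instance : IsGrCommutative (diffOp k A) (diffOpLT k A) where
  one_mem := fun a x => rfl
  mul_mem := mul_mem_diffOp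
  mul_mem_left {i j x y} hx hy := by
    rcases i with _ | i
    · rw [(Submodule.mem_bot A).1 hx, zero_mul]; exact zero_mem _
    · rw [Nat.add_right_comm]; exact mul_mem_diffOp hx hy
  mul_mem_right {i j x y} hx hy := by
    rcases j with _ | j
    · rw [(Submodule.mem_bot A).1 hy, mul_zero]; exact zero_mem _
    · exact mul_mem_diffOp hx hy
  comm_mem := comm_mem_diffOpLT

variable (k A)

/-- The piece `gr^n Diff` of operators of order `≤ n` modulo operators of order `< n`. -/
def GrDiffPiece (n : ℕ) : Type _ := GrPiece (diffOp k A) (diffOpLT k A) n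

instance (n : ℕ) : AddCommGroup (GrDiffPiece k A n) :=
  inferInstanceAs (AddCommGroup (GrPiece (diffOp k A) (diffOpLT k A) n))

instance (n : ℕ) : Module A (GrDiffPiece k A n) :=
  inferInstanceAs (Module A (GrPiece (diffOp k A) (diffOpLT k A) n))

instance : DirectSum.GCommRing (GrDiffPiece k A) :=
  inferInstanceAs (DirectSum.GCommRing (GrPiece (diffOp k A) (diffOpLT k A)))

instance : DirectSum.GAlgebra A (GrDiffPiece k A) :=
  inferInstanceAs (DirectSum.GAlgebra A (GrPiece (diffOp k A) (diffOpLT k A)))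

/-- The graded algebra of the ring of differential operators filtered by the order. -/
abbrev GrDiff : Type _ := ⨁ n, GrDiffPiece k A n

variable {k A}

/-- The class in `gr^n Diff` of an operator of order at most `n`. -/
def grDiffMk (n : ℕ) : ↥(diffOp k A n) →ₗ[A] GrDiffPiece k A n :=
  grMk (diffOp k A) (diffOpLT k A) n

theorem grDiffMk_surjective (n : ℕ) : Function.Surjective (grDiffMk (k := k) (A := A) n) :=
  grMk_surjective n

/-- The symbol `σ_n P` in `gr Diff` of an operator `P` of order at most `n`. -/
def symbol (n : ℕ) : ↥(diffOp k A n) →ₗ[A] GrDiff k A :=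
  DirectSum.lof A ℕ (GrDiffPiece k A) n ∘ₗ grDiffMk n

theorem symbol_eq {n : ℕ} {P Q : ↥(diffOp k A n)}
    (h : (P : Module.End k A) - Q ∈ diffOpLT k A n) : symbol n P = symbol n Q :=
  congrArg (DirectSum.lof A ℕ (GrDiffPiece k A) n) (grMk_eq_iff.2 h)

theorem symbol_mul {i j n : ℕ} (h : i + j = n) (P : ↥(diffOp k A i)) (Q : ↥(diffOp k A j)) :
    symbol i P * symbol j Q =
      symbol n ⟨(P * Q : Module.End k A), h ▸ mul_mem_diffOp P.2 Q.2⟩ := by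
  subst h
  exact DirectSum.of_mul_of _ _

theorem diffOp_mono : Monotone (diffOp k A) := monotone_nat_of_le_succ fun n => diffOpLT_le (n + 1)

end DiffOp

/-! ### Hasse--Schmidt derivations and integrable derivations -/

section HasseSchmidt

variable (k A : Type*) [CommRing k] [CommRing A] [Algebra k A]

/-- A Hasse--Schmidt derivation (of infinite length) of `A` over `k`. -/
structure HasseSchmidt where
  /-- The components of the Hasse--Schmidt derivation. -/
  toFun : ℕ → (Module.End k A)
  map_zero : toFun 0 = LinearMap.id
  leibniz : ∀ (n : ℕ) (x y : A),
    toFun n (x * y) = ∑ p ∈ Finset.HasAntidiagonal.antidiagonal n, toFun p.1 x * toFun p.2 y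

variable {k A}

namespace HasseSchmidt

theorem bracket_succ (D : HasseSchmidt k A) (n : ℕ) (a : A) :
    bracket a (D.toFun (n + 1)) =
      ∑ p ∈ Finset.HasAntidiagonal.antidiagonal n, D.toFun (p.1 + 1) a • D.toFun p.2 := by
  ext x
  simp [D.leibniz, Finset.Nat.sum_antidiagonal_succ, D.map_zero]

theorem mem_diffOp (D : HasseSchmidt k A) (n : ℕ) : D.toFun n ∈ diffOp k A n := by
  induction n using Nat.strong_induction_on with
  | _ n ih =>
    rcases n with _ | n
    · intro a x; simp [D.map_zero]
    · refine mem_diffOp_succ.2 fun a => ?_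
      rw [D.bracket_succ]
      refine sum_mem fun p hp => Submodule.smul_mem _ _ ?_
      have := Finset.HasAntidiagonal.mem_antidiagonal.1 hp
      exact diffOp_mono (by omega) (ih p.2 (by omega))

theorem bracket_sub_mem (D : HasseSchmidt k A) (n : ℕ) (a : A) :
    bracket a (D.toFun (n + 1)) - D.toFun 1 a • D.toFun n ∈ diffOpLT k A n := by
  rw [D.bracket_succ]
  rcases n with _ | n
  · simp
  · rw [Finset.Nat.sum_antidiagonal_succ, add_sub_cancel_left]
    refine sum_mem fun p hp => Submodule.smul_mem _ _ ?_
    have := Finset.HasAntidiagonal.mem_antidiagonal.1 hp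
    exact diffOp_mono (by omega) (D.mem_diffOp p.2)

/-- The symbols of the components only depend on the component of degree one. -/
theorem sub_mem_of_eq (D D' : HasseSchmidt k A) (h : D.toFun 1 = D'.toFun 1) (n : ℕ) :
    D.toFun n - D'.toFun n ∈ diffOpLT k A n := by
  induction n with
  | zero => rw [D.map_zero, D'.map_zero, sub_self]; exact zero_mem _
  | succ n ih =>
    refine mem_diffOp_iff.2 fun a => ?_
    have h1 := sub_mem (D.bracket_sub_mem n a) (D'.bracket_sub_mem n a)
    have h2 := add_mem h1 (Submodule.smul_mem _ (D.toFun 1 a) ih)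
    convert h2 using 1
    rw [map_sub, smul_sub, h]
    abel

theorem mul_sub_choose_mem (D : HasseSchmidt k A) (r s : ℕ) :
    (D.toFun r * D.toFun s - (r + s).choose r • D.toFun (r + s) : Module.End k A) ∈
      diffOpLT k A (r + s) := by
  induction hn : r + s generalizing r s with
  | zero =>
    obtain ⟨rfl, rfl⟩ : r = 0 ∧ s = 0 := by omega
    simp [D.map_zero, ← Module.End.one_eq_id]
  | succ n ih =>
    rcases r with _ | r
    · obtain rfl : s = n + 1 := by omega
      simp [D.map_zero, ← Module.End.one_eq_id]
    rcases s with _ | s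
    · obtain rfl : r = n := by omega
      simp [D.map_zero, ← Module.End.one_eq_id]
    obtain rfl : n = r + s + 1 := by omega
    refine mem_diffOp_iff.2 fun a => ?_
    set b := D.toFun 1 a with hb
    have hL {i j : ℕ} {x y : Module.End k A} (hx : x ∈ diffOpLT k A i)
        (hy : y ∈ diffOp k A j) : x * y ∈ diffOpLT k A (i + j) :=
      IsGrCommutative.mul_mem_left (F := diffOp k A) hx hy
    have hR {i j : ℕ} {x y : Module.End k A} (hx : x ∈ diffOp k A i)
        (hy : y ∈ diffOpLT k A j) : x * y ∈ diffOpLT k A (i + j) :=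
      IsGrCommutative.mul_mem_right (F := diffOp k A) hx hy
    have e1 : (bracket a (D.toFun (r + 1)) - b • D.toFun r) * D.toFun (s + 1) ∈
        diffOpLT k A (r + s + 1) := hL (j := s + 1) (D.bracket_sub_mem r a) (D.mem_diffOp _)
    have e2 : D.toFun (r + 1) * (bracket a (D.toFun (s + 1)) - b • D.toFun s) ∈
        diffOpLT k A (r + s + 1) := by
      have := hR (D.mem_diffOp (r + 1)) (D.bracket_sub_mem s a)
      rwa [show r + 1 + s = r + s + 1 by omega] at this
    have e3 : (bracket b (D.toFun (r + 1)) : Module.End k A) * D.toFun s ∈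
        diffOpLT k A (r + s + 1) :=
      mul_mem_diffOp (mem_diffOp_succ.1 (D.mem_diffOp (r + 1)) b) (D.mem_diffOp s)
    have e4 := Submodule.smul_mem _ b (ih r (s + 1) (by omega))
    have e5 := Submodule.smul_mem _ b (ih (r + 1) s (by omega))
    have e6 : (r + s + 2).choose (r + 1) • (bracket a (D.toFun (r + s + 2)) -
        b • D.toFun (r + s + 1)) ∈ diffOpLT k A (r + s + 1) :=
      (diffOpLT k A (r + s + 1)).smul_of_tower_mem _ (D.bracket_sub_mem (r + s + 1) a)
    have e := sub_mem (add_mem (add_mem (add_mem (add_mem e1 e2) e3) e4) e5) e6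
    convert e using 1
    have hc : (r + s + 2).choose (r + 1) = (r + s + 1).choose r + (r + s + 1).choose (r + 1) :=
      Nat.choose_succ_succ _ _
    rw [map_sub, bracket_mul, map_nsmul, show r + s + 1 + 1 = r + s + 2 by omega, hc]
    ext x
    simp only [LinearMap.sub_apply, LinearMap.add_apply, Module.End.mul_apply,
      LinearMap.smul_apply, bracket_apply, smul_eq_mul, map_sub]
    simp only [nsmul_eq_mul, Nat.cast_add]
    ring

/-- The composition `D ∘ D'`, with components `∑ i + j = n, D_i ∘ D'_j`. -/
def comp (D D' : HasseSchmidt k A) : HasseSchmidt k A where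
  toFun n := ∑ p ∈ Finset.HasAntidiagonal.antidiagonal n, D.toFun p.1 ∘ₗ D'.toFun p.2
  map_zero := by simp [D.map_zero, D'.map_zero]
  leibniz n x y := by
    simp only [LinearMap.coe_sum, Finset.sum_apply, LinearMap.comp_apply, D'.leibniz, map_sum,
      D.leibniz, Finset.sum_mul_sum, Finset.sum_sigma']
    refine Finset.sum_nbij'
      (fun q => ⟨(q.2.2.1 + q.2.1.1, q.2.2.2 + q.2.1.2), (q.2.2.1, q.2.1.1), (q.2.2.2, q.2.1.2)⟩)
      (fun q => ⟨(q.2.1.1 + q.2.2.1, q.2.1.2 + q.2.2.2), (q.2.1.2, q.2.2.2), (q.2.1.1, q.2.2.1)⟩)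
      ?_ ?_ ?_ ?_ ?_
    · rintro ⟨⟨i, j⟩, ⟨r, s⟩, ⟨p, q⟩⟩ h
      simp only [Finset.mem_sigma, Finset.HasAntidiagonal.mem_antidiagonal] at h ⊢
      refine ⟨?_, ?_, ?_⟩ <;> (try dsimp only) <;> omega
    · rintro ⟨⟨i, j⟩, ⟨r, s⟩, ⟨p, q⟩⟩ h
      simp only [Finset.mem_sigma, Finset.HasAntidiagonal.mem_antidiagonal] at h ⊢
      refine ⟨?_, ?_, ?_⟩ <;> (try dsimp only) <;> omega
    · rintro ⟨⟨i, j⟩, ⟨r, s⟩, ⟨p, q⟩⟩ h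
      simp only [Finset.mem_sigma, Finset.HasAntidiagonal.mem_antidiagonal] at h
      simp [h]
    · rintro ⟨⟨i, j⟩, ⟨r, s⟩, ⟨p, q⟩⟩ h
      simp only [Finset.mem_sigma, Finset.HasAntidiagonal.mem_antidiagonal] at h
      simp [h]
    · intro _ _
      rfl

/-- The Hasse--Schmidt derivation `a • D` with components `a ^ n D_n`. -/
def smul (a : A) (D : HasseSchmidt k A) : HasseSchmidt k A where
  toFun n := a ^ n • D.toFun n
  map_zero := by simp [D.map_zero]
  leibniz n x y := by
    simp only [LinearMap.smul_apply, D.leibniz, smul_eq_mul, Finset.mul_sum]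
    refine Finset.sum_congr rfl fun p hp => ?_
    rw [← Finset.HasAntidiagonal.mem_antidiagonal.1 hp, pow_add]
    ring

variable (k A) in
/-- The trivial Hasse--Schmidt derivation `(id, 0, 0, …)`. -/
def one : HasseSchmidt k A where
  toFun n := if n = 0 then LinearMap.id else 0
  map_zero := rfl
  leibniz n x y := by
    rcases n with _ | n
    · simp
    · rw [Finset.sum_eq_zero]
      · simp
      · intro p hp
        have := Finset.HasAntidiagonal.mem_antidiagonal.1 hp
        by_cases h : p.1 = 0
        · have : p.2 ≠ 0 := by omega
          simp [this]
        · simp [h]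

theorem comp_one (D D' : HasseSchmidt k A) :
    (D.comp D').toFun 1 = D.toFun 1 + D'.toFun 1 := by
  simp [comp, Finset.Nat.antidiagonal_succ, D.map_zero, D'.map_zero, add_comm]

end HasseSchmidt

variable (k A) in
/-- The `A`-module of integrable derivations: those which are the component of degree one of a
Hasse--Schmidt derivation of infinite length. -/
def IDer : Submodule A (Derivation k A A) where
  carrier := {δ | ∃ D : HasseSchmidt k A, D.toFun 1 = (δ : Module.End k A)}
  add_mem' := by
    rintro δ δ' ⟨D, hD⟩ ⟨D', hD'⟩
    exact ⟨D.comp D', by rw [D.comp_one, hD, hD']; rfl⟩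
  zero_mem' := ⟨HasseSchmidt.one k A, rfl⟩
  smul_mem' := by
    rintro a δ ⟨D, hD⟩
    exact ⟨D.smul a, by ext x; simp [HasseSchmidt.smul, hD]⟩

/-- The `n`-th coefficient of the total symbol `χ δ = ∑ σ_n(D_n) t ^ n`, where `D` is any integral
of `δ`; see `chi_eq` for the independence of the choice of `D`. -/
def chi (n : ℕ) (δ : IDer k A) : GrDiff k A :=
  symbol n ⟨δ.2.choose.toFun n, δ.2.choose.mem_diffOp n⟩

theorem chi_eq (n : ℕ) (δ : IDer k A) (D : HasseSchmidt k A)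
    (hD : D.toFun 1 = ((δ : Derivation k A A) : Module.End k A)) :
    chi n δ = symbol n ⟨D.toFun n, D.mem_diffOp n⟩ :=
  symbol_eq (HasseSchmidt.sub_mem_of_eq _ _ (δ.2.choose_spec.trans hD.symm) n)

theorem chi_zero (δ : IDer k A) : chi 0 δ = 1 := by
  refine congrArg (symbol 0) (Subtype.ext ?_)
  exact δ.2.choose.map_zero

theorem chi_smul (n : ℕ) (a : A) (δ : IDer k A) : chi n (a • δ) = a ^ n • chi n δ := by
  obtain ⟨D, hD⟩ := δ.2
  rw [chi_eq n δ D hD, chi_eq n (a • δ) (D.smul a) (by ext x; simp [HasseSchmidt.smul, hD]),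
    ← map_smul]
  rfl

theorem chi_mul (r s : ℕ) (δ : IDer k A) :
    chi r δ * chi s δ = (r + s).choose r • chi (r + s) δ := by
  obtain ⟨D, hD⟩ := δ.2
  simp only [chi_eq _ δ D hD]
  rw [symbol_mul rfl, ← map_nsmul]
  exact symbol_eq (D.mul_sub_choose_mem r s)

theorem chi_add (n : ℕ) (δ δ' : IDer k A) :
    chi n (δ + δ') = ∑ p ∈ Finset.HasAntidiagonal.antidiagonal n, chi p.1 δ * chi p.2 δ' := by
  obtain ⟨D, hD⟩ := δ.2
  obtain ⟨D', hD'⟩ := δ'.2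
  rw [chi_eq n (δ + δ') (D.comp D') (by rw [D.comp_one, hD, hD']; rfl)]
  simp only [chi_eq _ δ D hD, chi_eq _ δ' D' hD']
  rw [← Finset.sum_coe_sort, Finset.sum_congr rfl fun p _ =>
    symbol_mul (Finset.HasAntidiagonal.mem_antidiagonal.1 p.2) _ _, ← map_sum]
  refine congrArg (symbol n) (Subtype.ext ?_)
  simp only [AddSubmonoidClass.coe_finsetSum]
  exact (Finset.sum_coe_sort (Finset.HasAntidiagonal.antidiagonal n)
    (fun p => D.toFun p.1 ∘ₗ D'.toFun p.2)).symm

variable (k A) in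
/-- The canonical homomorphism `ϑ` from the divided power algebra of the module of integrable
derivations to `gr Diff`, which sends `γ_n(δ)` to `σ_n(D_n)` for any integral `D` of `δ`. -/
def vartheta : DividedPowerAlgebra A (IDer k A) →ₐ[A] GrDiff k A :=
  DividedPowerAlgebra.lift' (f := fun p : ℕ × IDer k A => chi p.1 p.2)
    (fun δ => chi_zero δ) (fun n a δ => chi_smul n a δ) (fun r s δ => chi_mul r s δ)
    (fun n δ δ' => chi_add n δ δ')

end HasseSchmidt

/-! ### The graded dual of the symmetric algebra -/

section GradedDual

variable (A M : Type*) [CommRing A] [AddCommGroup M] [Module A M]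

/-- The `n`-th symmetric power of `M`, as the component of degree `n` of the symmetric algebra. -/
def symPow (n : ℕ) : Submodule A (SymmetricAlgebra A M) :=
  LinearMap.range (SymmetricAlgebra.ι A M) ^ n

variable {A M}

theorem ι_mem_symPow (m : M) : SymmetricAlgebra.ι A M m ∈ symPow A M 1 := by
  rw [symPow, pow_one]; exact LinearMap.mem_range_self _ m

theorem ι_mul_mem_symPow {n : ℕ} (m : M) {x : SymmetricAlgebra A M} (hx : x ∈ symPow A M n) :
    SymmetricAlgebra.ι A M m * x ∈ symPow A M (n + 1) := by
  rw [symPow, pow_succ']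
  exact Submodule.mul_mem_mul (LinearMap.mem_range_self _ m) hx

instance : SetLike.GradedMonoid (symPow A M) :=
  inferInstanceAs (SetLike.GradedMonoid
    ((LinearMap.range (SymmetricAlgebra.ι A M) ^ ·) : ℕ → Submodule A _))

/-- The symmetric algebra is graded by the symmetric powers. -/
instance : GradedAlgebra (symPow A M) :=
  GradedAlgebra.ofAlgHom _
    (SymmetricAlgebra.lift (DirectSum.lof A ℕ (fun i => ↥(symPow A M i)) 1 ∘ₗ
      (SymmetricAlgebra.ι A M).codRestrict _ ι_mem_symPow))
    (by
      ext m
      change DirectSum.coeAlgHom (symPow A M) (SymmetricAlgebra.lift _ _) = _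
      rw [SymmetricAlgebra.lift_ι_apply, LinearMap.comp_apply, DirectSum.lof_eq_of,
        DirectSum.coeAlgHom_of]
      rfl)
    fun i x => by
      obtain ⟨x, hx⟩ := x
      dsimp only
      unfold symPow at hx
      induction hx using Submodule.pow_induction_on_left' with
      | algebraMap r => rw [AlgHom.commutes, DirectSum.algebraMap_apply]; rfl
      | add x y i hx hy ihx ihy =>
        rw [map_add, ihx, ihy, ← map_add]
        rfl
      | mem_mul m hm i x hx ih =>
        obtain ⟨m, rfl⟩ := hm
        rw [map_mul, ih, SymmetricAlgebra.lift_ι_apply, LinearMap.comp_apply, DirectSum.lof_eq_of,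
          DirectSum.of_mul_of]
        exact DirectSum.of_eq_of_gradedMonoid_eq (Sigma.subtype_ext (add_comm _ _) rfl)

variable (A M)

/-- The projection of the symmetric algebra onto its component of degree `n`. -/
def symProj (n : ℕ) : SymmetricAlgebra A M →ₗ[A] ↥(symPow A M n) :=
  DirectSum.component A ℕ (fun i => ↥(symPow A M i)) n ∘ₗ
    (DirectSum.decomposeLinearEquiv (symPow A M)).toLinearMap

variable {A M}

theorem symProj_of_mem {n : ℕ} {x : SymmetricAlgebra A M} (hx : x ∈ symPow A M n) :
    symProj A M n x = ⟨x, hx⟩ :=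
  Subtype.ext (DirectSum.decompose_of_mem_same _ hx)

theorem symProj_of_mem_ne {m n : ℕ} {x : SymmetricAlgebra A M} (hx : x ∈ symPow A M m)
    (h : m ≠ n) : symProj A M n x = 0 :=
  Subtype.ext (DirectSum.decompose_of_mem_ne _ hx h)

theorem symPow_ext {N : Type*} [AddCommGroup N] [Module A N] {f g : SymmetricAlgebra A M →ₗ[A] N}
    (h : ∀ n, ∀ x ∈ symPow A M n, f x = g x) : f = g := by
  ext x
  induction x using DirectSum.Decomposition.inductionOn (symPow A M) with
  | zero => simp
  | homogeneous x => exact h _ _ x.2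
  | add x y hx hy => rw [map_add, map_add, hx, hy]

/-- The convolution algebra of linear forms on the symmetric algebra; its product is the transpose
of the coproduct `Δ` with `Δ m = m ⊗ 1 + 1 ⊗ m` for `m ∈ M`. -/
abbrev SymConv (A M : Type*) [CommRing A] [AddCommGroup M] [Module A M] : Type _ :=
  WithConv (SymmetricAlgebra A M →ₗ[A] A)

/-- Extension by zero of a linear form on the `n`-th symmetric power. -/
def dualExt (n : ℕ) : Module.Dual A ↥(symPow A M n) →ₗ[A] SymConv A M where
  toFun u := WithConv.toConv (u ∘ₗ symProj A M n)
  map_add' _ _ := rfl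
  map_smul' _ _ := rfl

/-- Restriction of a linear form to the `n`-th symmetric power. -/
def dualRes (n : ℕ) : SymConv A M →ₗ[A] Module.Dual A ↥(symPow A M n) where
  toFun f := f.ofConv ∘ₗ (symPow A M n).subtype
  map_add' _ _ := rfl
  map_smul' _ _ := rfl

theorem dualExt_of_mem {n : ℕ} (u : Module.Dual A ↥(symPow A M n)) {x : SymmetricAlgebra A M}
    (hx : x ∈ symPow A M n) : dualExt n u x = u ⟨x, hx⟩ :=
  congrArg u (symProj_of_mem hx)

theorem dualExt_of_mem_ne {m n : ℕ} (u : Module.Dual A ↥(symPow A M n)) {x : SymmetricAlgebra A M}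
    (hx : x ∈ symPow A M m) (h : m ≠ n) : dualExt n u x = 0 :=
  (congrArg u (symProj_of_mem_ne hx h)).trans (map_zero u)

theorem dualRes_dualExt {n : ℕ} (u : Module.Dual A ↥(symPow A M n)) :
    dualRes n (dualExt n u) = u := by
  ext x
  exact dualExt_of_mem u x.2

theorem dualExt_injective (n : ℕ) : Function.Injective (dualExt (A := A) (M := M) n) :=
  Function.LeftInverse.injective dualRes_dualExt

theorem dualExt_dualRes {n : ℕ} {f : SymConv A M}
    (hf : ∀ m ≠ n, ∀ x ∈ symPow A M m, f x = 0) : dualExt n (dualRes n f) = f := by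
  refine WithConv.ofConv_injective (symPow_ext fun m x hx => ?_)
  by_cases h : m = n
  · subst h
    exact dualExt_of_mem _ hx
  · exact (dualExt_of_mem_ne _ hx h).trans (hf m h x hx).symm

theorem comul_mem {n : ℕ} {x : SymmetricAlgebra A M} (hx : x ∈ symPow A M n) :
    Coalgebra.comul (R := A) x ∈ Submodule.span A
      {z : SymmetricAlgebra A M ⊗[A] SymmetricAlgebra A M | ∃ i j : ℕ, i + j = n ∧
        ∃ y ∈ symPow A M i, ∃ y' ∈ symPow A M j, y ⊗ₜ[A] y' = z} := by
  unfold symPow at hx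
  induction hx using Submodule.pow_induction_on_left' with
  | algebraMap r =>
    rw [Bialgebra.comul_algebraMap, Algebra.TensorProduct.algebraMap_apply]
    refine Submodule.subset_span ⟨0, 0, rfl, _, ?_, 1, ?_, rfl⟩
    · exact SetLike.algebraMap_mem_graded (symPow A M) r
    · exact SetLike.one_mem_graded (symPow A M)
  | add x y i hx hy ihx ihy => rw [map_add]; exact add_mem ihx ihy
  | mem_mul m hm i x hx ih =>
    obtain ⟨m, rfl⟩ := hm
    rw [Bialgebra.comul_mul, SymmetricAlgebra.comul_ι]
    generalize Coalgebra.comul (R := A) x = z at ih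
    induction ih using Submodule.span_induction with
    | mem z hz =>
      obtain ⟨i, j, rfl, y, hy, y', hy', rfl⟩ := hz
      rw [add_mul, Algebra.TensorProduct.tmul_mul_tmul, Algebra.TensorProduct.tmul_mul_tmul,
        one_mul, one_mul]
      refine add_mem (Submodule.subset_span ?_) (Submodule.subset_span ?_)
      · exact ⟨i + 1, j, by omega, _, ι_mul_mem_symPow m hy, _, hy', rfl⟩
      · exact ⟨i, j + 1, by omega, _, hy, _, ι_mul_mem_symPow m hy', rfl⟩
    | zero => rw [mul_zero]; exact zero_mem _
    | add z w _ _ hz hw => rw [mul_add]; exact add_mem hz hw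
    | smul a z _ hz => rw [mul_smul_comm]; exact Submodule.smul_mem _ a hz

theorem conv_apply_eq_zero {i j m : ℕ} (u : Module.Dual A ↥(symPow A M i))
    (v : Module.Dual A ↥(symPow A M j)) (h : m ≠ i + j) {x : SymmetricAlgebra A M}
    (hx : x ∈ symPow A M m) : (dualExt i u * dualExt j v) x = 0 := by
  rw [LinearMap.convMul_apply]
  have hz := comul_mem hx
  generalize Coalgebra.comul (R := A) x = z at hz
  induction hz using Submodule.span_induction with
  | mem z hz =>
    obtain ⟨a, b, rfl, y, hy, y', hy', rfl⟩ := hz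
    rw [TensorProduct.map_tmul, LinearMap.mul'_apply]
    by_cases ha : a = i
    · have hb : b ≠ j := by omega
      have h0 : (dualExt j v).ofConv y' = 0 := dualExt_of_mem_ne v hy' hb
      rw [h0, mul_zero]
    · have h0 : (dualExt i u).ofConv y = 0 := dualExt_of_mem_ne u hy ha
      rw [h0, zero_mul]
  | zero => simp
  | add z w _ _ hz hw => rw [map_add, map_add, hz, hw, add_zero]
  | smul a z _ hz => rw [map_smul, map_smul, hz, smul_zero]

/-- The dual `(Sym^n M)^*` of the `n`-th symmetric power. -/
abbrev SymDualPiece (A M : Type*) [CommRing A] [AddCommGroup M] [Module A M] (n : ℕ) : Type _ :=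
  Module.Dual A ↥(symPow A M n)

/-- The shuffle product `(Sym^i M)^* × (Sym^j M)^* → (Sym^(i+j) M)^*`, that is, the composition of
`u ⊗ v` with the component `Sym^(i+j) M → Sym^i M ⊗ Sym^j M` of the coproduct. -/
def shuffle {i j : ℕ} (u : SymDualPiece A M i) (v : SymDualPiece A M j) :
    SymDualPiece A M (i + j) :=
  dualRes (i + j) (dualExt i u * dualExt j v)

theorem dualExt_shuffle {i j : ℕ} (u : SymDualPiece A M i) (v : SymDualPiece A M j) :
    dualExt (i + j) (shuffle u v) = dualExt i u * dualExt j v :=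
  dualExt_dualRes fun _ hm _ hx => conv_apply_eq_zero u v hm hx

/-- The unit of the shuffle product: the form on `Sym^0 M = A` which is the identity of `A`. -/
def shuffleOne : SymDualPiece A M 0 := dualRes 0 (1 : SymConv A M)

theorem dualExt_shuffleOne : dualExt 0 (shuffleOne : SymDualPiece A M 0) = 1 := by
  refine dualExt_dualRes fun m hm x hx => ?_
  obtain ⟨m, rfl⟩ := Nat.exists_eq_succ_of_ne_zero hm
  rw [symPow, pow_succ'] at hx
  induction hx using Submodule.mul_induction_on' with
  | mem_mul_mem y hy z hz =>
    obtain ⟨y, rfl⟩ := hy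
    simp
  | add y _ z _ hy hz =>
    have h : (1 : SymConv A M) (y + z) = (1 : SymConv A M) y + (1 : SymConv A M) z :=
      map_add (1 : SymConv A M).ofConv y z
    rw [h, hy, hz, add_zero]

theorem symDual_mk_eq {m n : ℕ} (h : m = n) {u : SymDualPiece A M m} {v : SymDualPiece A M n}
    (huv : dualExt m u = dualExt n v) :
    GradedMonoid.mk m u = GradedMonoid.mk n v := by
  subst h
  rw [dualExt_injective m huv]

instance : GradedMonoid.GMul (SymDualPiece A M) := ⟨shuffle⟩

instance : GradedMonoid.GOne (SymDualPiece A M) := ⟨shuffleOne⟩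

instance : GradedMonoid.GCommMonoid (SymDualPiece A M) where
  one_mul := by
    rintro ⟨i, u⟩
    refine symDual_mk_eq (zero_add i) ?_
    change dualExt _ (shuffle shuffleOne u) = dualExt _ u
    rw [dualExt_shuffle, dualExt_shuffleOne, one_mul]
  mul_one := by
    rintro ⟨i, u⟩
    refine symDual_mk_eq (add_zero i) ?_
    change dualExt _ (shuffle u shuffleOne) = dualExt _ u
    rw [dualExt_shuffle, dualExt_shuffleOne, mul_one]
  mul_assoc := by
    rintro ⟨i, u⟩ ⟨j, v⟩ ⟨l, w⟩
    refine symDual_mk_eq (add_assoc i j l) ?_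
    change dualExt _ (shuffle (shuffle u v) w) = dualExt _ (shuffle u (shuffle v w))
    simp only [dualExt_shuffle, mul_assoc]
  mul_comm := by
    rintro ⟨i, u⟩ ⟨j, v⟩
    refine symDual_mk_eq (add_comm i j) ?_
    change dualExt _ (shuffle u v) = dualExt _ (shuffle v u)
    simp only [dualExt_shuffle, mul_comm]

instance : DirectSum.GCommRing (SymDualPiece A M) where
  __ := (inferInstance : GradedMonoid.GCommMonoid (SymDualPiece A M))
  mul_zero {i j} u := by
    change dualRes (i + j) (dualExt i u * dualExt j 0) = 0
    rw [map_zero, mul_zero, map_zero]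
  zero_mul {i j} u := by
    change dualRes (i + j) (dualExt i 0 * dualExt j u) = 0
    rw [map_zero, zero_mul, map_zero]
  mul_add {i j} u v w := by
    change dualRes (i + j) (dualExt i u * dualExt j (v + w)) =
      dualRes (i + j) (dualExt i u * dualExt j v) + dualRes (i + j) (dualExt i u * dualExt j w)
    rw [map_add, mul_add, map_add]
  add_mul {i j} u v w := by
    change dualRes (i + j) (dualExt i (u + v) * dualExt j w) =
      dualRes (i + j) (dualExt i u * dualExt j w) + dualRes (i + j) (dualExt i v * dualExt j w)
    rw [map_add, add_mul, map_add]
  natCast n := n • GradedMonoid.GOne.one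
  natCast_zero := zero_smul _ _
  natCast_succ n := succ_nsmul _ _
  intCast n := n • GradedMonoid.GOne.one
  intCast_ofNat n := natCast_zsmul _ _
  intCast_negSucc_ofNat n := negSucc_zsmul _ _

theorem dualExt_smul_shuffle {i : ℕ} (r : A) (u : SymDualPiece A M i) :
    dualExt (0 + i) (shuffle (r • shuffleOne) u) = r • dualExt i u := by
  rw [dualExt_shuffle, LinearMap.map_smul, dualExt_shuffleOne, smul_mul_assoc, one_mul]

instance : DirectSum.GAlgebra A (SymDualPiece A M) where
  toFun := (LinearMap.toSpanSingleton A (SymDualPiece A M 0) shuffleOne).toAddMonoidHom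
  map_one := one_smul A (shuffleOne : SymDualPiece A M 0)
  map_mul r s := by
    have h : GradedMonoid.mk 0 ((r * s) • (shuffleOne : SymDualPiece A M 0)) =
        GradedMonoid.mk (0 + 0) (shuffle (r • (shuffleOne : SymDualPiece A M 0))
          (s • (shuffleOne : SymDualPiece A M 0))) := by
      refine symDual_mk_eq (zero_add 0).symm ?_
      rw [dualExt_smul_shuffle, LinearMap.map_smul, LinearMap.map_smul, mul_smul]
    exact h
  commutes r x := mul_comm _ _
  smul_def r x := by
    have h : GradedMonoid.mk x.1 (r • x.2) =
        GradedMonoid.mk (0 + x.1) (shuffle (r • (shuffleOne : SymDualPiece A M 0)) x.2) := by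
      refine symDual_mk_eq (zero_add x.1).symm ?_
      rw [dualExt_smul_shuffle, LinearMap.map_smul]
    exact h

variable (A M) in
/-- The graded dual `(Sym M)^*_gr` with the shuffle product. -/
abbrev SymGrDual : Type _ := ⨁ n, SymDualPiece A M n

instance : CommRing (SymGrDual A M) := DirectSum.commRing (SymDualPiece A M)

instance : Algebra A (SymGrDual A M) := DirectSum.instAlgebra A (SymDualPiece A M)

end GradedDual

/-! ### Principal parts, the map `υ` and the embedding `θ` -/

section Theta

variable (k A : Type*) [CommRing k] [CommRing A] [Algebra k A]

/-- The power `I ^ n` of the kernel `I` of the multiplication `A ⊗ A → A`, as a submodule for the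
left `A`-module structure `a (b ⊗ c) = a b ⊗ c`. -/
def diagPow (n : ℕ) : Submodule A (A ⊗[k] A) :=
  (KaehlerDifferential.ideal k A ^ n).restrictScalars A

instance : IsGrCommutative (diagPow k A) (fun n => diagPow k A (n + 1)) where
  one_mem := by simp [diagPow]
  mul_mem {i j x y} hx hy := by
    change _ ∈ KaehlerDifferential.ideal k A ^ (i + j)
    rw [pow_add]; exact Ideal.mul_mem_mul hx hy
  mul_mem_left {i j x y} hx hy := by
    change _ ∈ KaehlerDifferential.ideal k A ^ (i + j + 1)
    rw [Nat.add_right_comm, pow_add]; exact Ideal.mul_mem_mul hx hy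
  mul_mem_right {i j x y} hx hy := by
    change _ ∈ KaehlerDifferential.ideal k A ^ (i + j + 1)
    rw [Nat.add_assoc, pow_add]; exact Ideal.mul_mem_mul hx hy
  comm_mem {i j x y} hx hy := by rw [mul_comm, sub_self]; exact zero_mem _

/-- The piece `I ^ n / I ^ (n + 1)`. -/
abbrev GrIPiece (n : ℕ) : Type _ := GrPiece (diagPow k A) (fun n => diagPow k A (n + 1)) n

/-- The graded algebra `gr_I (A ⊗ A) = ⨁ n, I ^ n / I ^ (n + 1)`. -/
abbrev GrI : Type _ := ⨁ n, GrIPiece k A n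

variable {k A} in
/-- The class in `I ^ n / I ^ (n + 1)` of an element of `I ^ n`. -/
abbrev grIMk (n : ℕ) : ↥(diagPow k A n) →ₗ[A] GrIPiece k A n :=
  grMk (diagPow k A) (fun n => diagPow k A (n + 1)) n

/-- The canonical map `Ω = I / I ^ 2 → I ^ 1 / I ^ 2`. -/
def upsilonOne : Ω[A⁄k] →ₗ[A] GrIPiece k A 1 :=
  (((KaehlerDifferential.ideal k A •
      (⊤ : Submodule (A ⊗[k] A) (KaehlerDifferential.ideal k A))).restrictScalars A).liftQ
    (grIMk 1 ∘ₗ ((KaehlerDifferential.ideal k A).subtype.restrictScalars A).codRestrict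
      (diagPow k A 1) fun x => by
        change _ ∈ KaehlerDifferential.ideal k A ^ 1
        rw [pow_one]; exact x.2)
    (fun x hx => by
      rw [LinearMap.mem_ker, LinearMap.comp_apply, grMk_eq_zero]
      change (x : A ⊗[k] A) ∈ KaehlerDifferential.ideal k A ^ 2
      rw [pow_two]
      refine Submodule.smul_induction_on ((Submodule.restrictScalars_mem _ _ _).1 hx) ?_ ?_
      · intro r hr y _
        exact Ideal.mul_mem_mul hr y.2
      · intro y z hy hz
        exact add_mem hy hz)) ∘ₗ
    (Submodule.Quotient.restrictScalarsEquiv A _).symm.toLinearMap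

/-- The canonical epimorphism `υ : Sym Ω → gr_I (A ⊗ A)` of graded algebras, which extends the
identity `Ω = I / I ^ 2`. -/
def upsilon : SymmetricAlgebra A Ω[A⁄k] →ₐ[A] GrI k A :=
  SymmetricAlgebra.lift (DirectSum.lof A ℕ (GrIPiece k A) 1 ∘ₗ upsilonOne k A)

/-- The component `υ_n : Sym^n Ω → I ^ n / I ^ (n + 1)` of degree `n` of `υ`. -/
def upsilonDeg (n : ℕ) : ↥(symPow A Ω[A⁄k] n) →ₗ[A] GrIPiece k A n :=
  DirectSum.component A ℕ (GrIPiece k A) n ∘ₗ (upsilon k A).toLinearMap ∘ₗ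
    (symPow A Ω[A⁄k] n).subtype

/-- The left `A`-linear map `P ↦ P~` with `P~ (a ⊗ b) = a P(b)`. -/
def linearize : (Module.End k A) →ₗ[A] (A ⊗[k] A →ₗ[A] A) where
  toFun P := TensorProduct.AlgebraTensorModule.lift
    ((LinearMap.lsmul A (Module.End k A)).flip P)
  map_add' P Q := by ext; simp
  map_smul' a P := by ext; simp

variable {k A}

@[simp]
theorem linearize_tmul (P : Module.End k A) (a b : A) : linearize k A P (a ⊗ₜ b) = a * P b := rfl

theorem linearize_mul (P : Module.End k A) (a : A) (z : A ⊗[k] A) :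
    linearize k A P ((1 ⊗ₜ a - a ⊗ₜ 1) * z) = linearize k A (bracket a P) z := by
  induction z with
  | zero => simp
  | add x y hx hy => rw [mul_add, map_add, map_add, hx, hy]
  | tmul x y =>
    rw [sub_mul, Algebra.TensorProduct.tmul_mul_tmul, Algebra.TensorProduct.tmul_mul_tmul, map_sub]
    simp
    ring

theorem linearize_eq_zero {n : ℕ} {P : Module.End k A} (hP : P ∈ diffOpLT k A n) {z : A ⊗[k] A}
    (hz : z ∈ diagPow k A n) : linearize k A P z = 0 := by
  induction n generalizing P z with
  | zero => rw [(Submodule.mem_bot A).1 hP, map_zero, LinearMap.zero_apply]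
  | succ n ih =>
    replace hz : z ∈ KaehlerDifferential.ideal k A ^ (n + 1) := hz
    rw [pow_succ'] at hz
    induction hz using Submodule.mul_induction_on' with
    | mem_mul_mem x hx y hy =>
      replace hx : x ∈ (KaehlerDifferential.ideal k A).restrictScalars A := hx
      rw [← KaehlerDifferential.submodule_span_range_eq_ideal] at hx
      induction hx using Submodule.span_induction with
      | mem x hx =>
        obtain ⟨a, rfl⟩ := hx
        exact (linearize_mul P a y).trans (ih (mem_diffOp_iff.1 hP a) hy)
      | zero => rw [zero_mul, map_zero]
      | add x x' _ _ hx hx' => rw [add_mul, map_add, hx, hx', add_zero]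
      | smul a x _ hx => rw [smul_mul_assoc, map_smul, hx, smul_zero]
    | add x _ y _ hx hy => rw [map_add, hx, hy, add_zero]

variable (k A)

/-- The map `λ_n : gr^n Diff → Hom_A (I ^ n / I ^ (n + 1), A)` which sends `σ_n P` to the
restriction of `P~`. -/
def lambda (n : ℕ) : GrDiffPiece k A n →ₗ[A] Module.Dual A (GrIPiece k A n) :=
  grLift n
    { toFun := fun P => grLift n (linearize k A P ∘ₗ (diagPow k A n).subtype)
        fun z hz => linearize_eq_zero (n := n + 1) P.2 hz
      map_add' := fun P Q => by
        ext z
        obtain ⟨z, rfl⟩ := grMk_surjective _ z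
        simp
      map_smul' := fun a P => by
        ext z
        obtain ⟨z, rfl⟩ := grMk_surjective _ z
        simp }
    fun P hP => by
      ext z
      obtain ⟨z, rfl⟩ := grMk_surjective _ z
      exact linearize_eq_zero hP z.2

/-- The map `θ_n : gr^n Diff → (Sym^n Ω)^*`, the composition of `λ_n` and the transpose of
`υ_n`. -/
def thetaDeg (n : ℕ) : GrDiffPiece k A n →ₗ[A] SymDualPiece A Ω[A⁄k] n :=
  (upsilonDeg k A n).dualMap ∘ₗ lambda k A n

variable {k A}

theorem thetaDeg_grMk {n : ℕ} (P : ↥(diffOp k A n)) (x : ↥(symPow A Ω[A⁄k] n))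
    (z : ↥(diagPow k A n)) (h : upsilonDeg k A n x = grIMk n z) :
    thetaDeg k A n (grDiffMk n P) x =
      linearize k A P z := by
  rw [thetaDeg, LinearMap.comp_apply, LinearMap.dualMap_apply, h]
  rfl

theorem upsilon_D (a : A) : upsilon k A (SymmetricAlgebra.ι A _ (KaehlerDifferential.D k A a)) =
    DirectSum.of (GrIPiece k A) 1 (grIMk 1 ⟨1 ⊗ₜ a - a ⊗ₜ 1, by
      change _ ∈ KaehlerDifferential.ideal k A ^ 1
      rw [pow_one]
      exact KaehlerDifferential.one_smul_sub_smul_one_mem_ideal k a⟩) := by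
  rw [upsilon, SymmetricAlgebra.lift_ι_apply]
  rfl

/-- `Sym Ω` is generated by `1` and the products `da * x`. -/
theorem sym_induction {p : SymmetricAlgebra A Ω[A⁄k] → Prop} (h1 : p 1)
    (hD : ∀ a x, p x → p (SymmetricAlgebra.ι A _ (KaehlerDifferential.D k A a) * x))
    (hadd : ∀ x y, p x → p y → p (x + y)) (hsmul : ∀ (a : A) x, p x → p (a • x))
    (x : SymmetricAlgebra A Ω[A⁄k]) : p x := by
  have key : ∀ y x : SymmetricAlgebra A Ω[A⁄k], p x → p (y * x) := by
    intro y
    induction y using SymmetricAlgebra.induction with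
    | algebraMap r =>
      intro x hx
      rw [← Algebra.smul_def]; exact hsmul r x hx
    | ι w =>
      have hw : w ∈ Submodule.span A (Set.range (KaehlerDifferential.D k A)) := by
        rw [KaehlerDifferential.span_range_derivation]; trivial
      induction hw using Submodule.span_induction with
      | mem w hw =>
        obtain ⟨a, rfl⟩ := hw
        exact hD a
      | zero =>
        intro x hx
        rw [map_zero, zero_mul, ← zero_smul A x]; exact hsmul 0 x hx
      | add w w' _ _ hw hw' =>
        intro x hx
        rw [map_add, add_mul]; exact hadd _ _ (hw x hx) (hw' x hx)
      | smul a w _ hw =>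
        intro x hx
        rw [map_smul, smul_mul_assoc]; exact hsmul _ _ (hw x hx)
    | mul y z hy hz =>
      intro x hx
      rw [mul_assoc]; exact hy _ (hz x hx)
    | add y z hy hz =>
      intro x hx
      rw [add_mul]; exact hadd _ _ (hy x hx) (hz x hx)
  simpa using key x 1 h1

theorem symConv_ext {f g : SymConv A Ω[A⁄k]} (h1 : f 1 = g 1)
    (hD : ∀ a x, f (SymmetricAlgebra.ι A _ (KaehlerDifferential.D k A a) * x) =
      g (SymmetricAlgebra.ι A _ (KaehlerDifferential.D k A a) * x)) : f = g := by
  refine WithConv.ofConv_injective (LinearMap.ext fun x => ?_)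
  induction x using sym_induction with
  | h1 => exact h1
  | hD a x _ => exact hD a x
  | hadd x y hx hy => rw [map_add, map_add, hx, hy]
  | hsmul a x hx => rw [map_smul, map_smul, hx]

/-- Contraction of a linear form on the symmetric algebra with an element of the module. -/
def contract {A M : Type*} [CommRing A] [AddCommGroup M] [Module A M] (m : M) (f : SymConv A M) :
    SymConv A M :=
  WithConv.toConv (f.ofConv ∘ₗ LinearMap.mulLeft A (SymmetricAlgebra.ι A M m))

theorem contract_apply {A M : Type*} [CommRing A] [AddCommGroup M] [Module A M] (m : M)
    (f : SymConv A M) (x : SymmetricAlgebra A M) :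
    contract m f x = f (SymmetricAlgebra.ι A M m * x) := rfl

theorem contract_mul {A M : Type*} [CommRing A] [AddCommGroup M] [Module A M] (m : M)
    (f g : SymConv A M) :
    contract m (f * g) = contract m f * g + f * contract m g := by
  refine WithConv.ofConv_injective (LinearMap.ext fun x => ?_)
  change (f * g) (SymmetricAlgebra.ι A M m * x) = (contract m f * g) x + (f * contract m g) x
  simp only [LinearMap.convMul_apply, Bialgebra.comul_mul, SymmetricAlgebra.comul_ι]
  generalize Coalgebra.comul (R := A) x = z
  induction z with
  | zero => simp
  | add x y hx hy =>
    simp only [mul_add, map_add] at hx hy ⊢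
    rw [hx, hy]; abel
  | tmul x y =>
    rw [add_mul, Algebra.TensorProduct.tmul_mul_tmul, Algebra.TensorProduct.tmul_mul_tmul]
    simp [contract]

theorem of_mul_of_grIMk {n : ℕ} (y : ↥(diagPow k A 1)) (z : ↥(diagPow k A n)) :
    ∃ w : ↥(diagPow k A (n + 1)), (w : A ⊗[k] A) = y * z ∧
      DirectSum.of (GrIPiece k A) 1 (grIMk 1 y) * DirectSum.of (GrIPiece k A) n (grIMk n z) =
        DirectSum.of (GrIPiece k A) (n + 1) (grIMk (n + 1) w) := by
  have h : (y * z : A ⊗[k] A) ∈ diagPow k A (n + 1) := by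
    rw [add_comm n 1]
    exact IsGrCommutative.mul_mem (G := fun n => diagPow k A (n + 1)) y.2 z.2
  refine ⟨⟨_, h⟩, rfl, ?_⟩
  rw [DirectSum.of_mul_of]
  refine DirectSum.of_eq_of_gradedMonoid_eq (grMk_mk_eq (add_comm 1 n) ?_)
  rw [sub_self]; exact zero_mem _

theorem upsilon_of_mem {n : ℕ} {x : SymmetricAlgebra A Ω[A⁄k]} (hx : x ∈ symPow A Ω[A⁄k] n) :
    ∃ z : ↥(diagPow k A n), upsilon k A x = DirectSum.of (GrIPiece k A) n (grIMk n z) := by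
  unfold symPow at hx
  induction hx using Submodule.pow_induction_on_left' with
  | algebraMap r =>
    refine ⟨r • ⟨1, IsGrCommutative.one_mem (G := fun n => diagPow k A (n + 1))⟩, ?_⟩
    rw [AlgHom.commutes]; rfl
  | add x y i hx hy ihx ihy =>
    obtain ⟨z, hz⟩ := ihx
    obtain ⟨w, hw⟩ := ihy
    exact ⟨z + w, by rw [map_add, hz, hw, ← map_add, ← map_add]⟩
  | mem_mul m hm i x hx ih =>
    obtain ⟨m, rfl⟩ := hm
    obtain ⟨z, hz⟩ := ih
    obtain ⟨y, hy⟩ := grMk_surjective _ (upsilonOne k A m)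
    obtain ⟨w, -, hw⟩ := of_mul_of_grIMk y z
    refine ⟨w, ?_⟩
    rw [map_mul, hz, ← hw, upsilon, SymmetricAlgebra.lift_ι_apply, LinearMap.comp_apply, ← hy]
    rfl

theorem upsilonDeg_mul {n : ℕ} (a : A) {x : SymmetricAlgebra A Ω[A⁄k]}
    (hx : x ∈ symPow A Ω[A⁄k] n) :
    ∃ z : ↥(diagPow k A n), upsilonDeg k A n ⟨x, hx⟩ = grIMk n z ∧
      ∃ w : ↥(diagPow k A (n + 1)), (w : A ⊗[k] A) = (1 ⊗ₜ a - a ⊗ₜ 1) * (z : A ⊗[k] A) ∧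
        upsilonDeg k A (n + 1) ⟨SymmetricAlgebra.ι A _ (KaehlerDifferential.D k A a) * x,
          ι_mul_mem_symPow (KaehlerDifferential.D k A a) hx⟩ = grIMk (n + 1) w := by
  obtain ⟨z, hz⟩ := upsilon_of_mem hx
  refine ⟨z, ?_, ?_⟩
  · change (upsilon k A x) n = _
    rw [hz]
    exact DirectSum.of_eq_same _ _
  · obtain ⟨w, hw, hzw⟩ := of_mul_of_grIMk ⟨1 ⊗ₜ a - a ⊗ₜ 1, by
      change _ ∈ KaehlerDifferential.ideal k A ^ 1
      rw [pow_one]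
      exact KaehlerDifferential.one_smul_sub_smul_one_mem_ideal k a⟩ z
    refine ⟨w, hw, ?_⟩
    change (upsilon k A (_ * x)) (n + 1) = _
    rw [map_mul, upsilon_D, hz, hzw]
    exact DirectSum.of_eq_same _ _

/-- The linear form on `Sym Ω` given by `θ_n (σ_n P)` in degree `n` and zero in other degrees. -/
def thetaExt (n : ℕ) (P : ↥(diffOp k A n)) : SymConv A Ω[A⁄k] :=
  dualExt n (thetaDeg k A n (grDiffMk n P))

theorem thetaExt_zero_one (P : ↥(diffOp k A 0)) : thetaExt 0 P 1 = (P : Module.End k A) 1 := by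
  rw [thetaExt, dualExt_of_mem _ (SetLike.one_mem_graded (symPow A Ω[A⁄k]))]
  have h : upsilonDeg k A 0 ⟨1, SetLike.one_mem_graded (symPow A Ω[A⁄k])⟩ =
      grIMk 0 ⟨1, IsGrCommutative.one_mem (G := fun n => diagPow k A (n + 1))⟩ := by
    change (upsilon k A 1) 0 = _
    rw [map_one]
    exact DirectSum.of_eq_same _ _
  rw [thetaDeg_grMk _ _ _ h]
  exact (linearize_tmul (P : Module.End k A) 1 1).trans (one_mul _)

theorem thetaExt_succ_one {n : ℕ} (P : ↥(diffOp k A (n + 1))) : thetaExt (n + 1) P 1 = 0 :=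
  dualExt_of_mem_ne _ (SetLike.one_mem_graded (symPow A Ω[A⁄k])) (Nat.succ_ne_zero n).symm

theorem contract_thetaExt_zero (a : A) (P : ↥(diffOp k A 0)) :
    contract (KaehlerDifferential.D k A a) (thetaExt 0 P) = 0 := by
  refine WithConv.ofConv_injective (symPow_ext fun m x hx => ?_)
  change thetaExt 0 P (SymmetricAlgebra.ι A _ (KaehlerDifferential.D k A a) * x) = 0
  exact dualExt_of_mem_ne _ (ι_mul_mem_symPow _ hx) (Nat.succ_ne_zero m)

theorem contract_thetaExt_succ {n : ℕ} (a : A) (P : ↥(diffOp k A (n + 1))) :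
    contract (KaehlerDifferential.D k A a) (thetaExt (n + 1) P) =
      thetaExt n ⟨bracket a P, mem_diffOp_succ.1 P.2 a⟩ := by
  refine WithConv.ofConv_injective (symPow_ext fun m x hx => ?_)
  change thetaExt (n + 1) P (SymmetricAlgebra.ι A _ (KaehlerDifferential.D k A a) * x) =
    thetaExt n ⟨bracket a P, mem_diffOp_succ.1 P.2 a⟩ x
  by_cases h : m = n
  · subst h
    obtain ⟨z, hz, w, hw, hzw⟩ := upsilonDeg_mul a hx
    rw [thetaExt, thetaExt, dualExt_of_mem _ hx, dualExt_of_mem _ (ι_mul_mem_symPow _ hx)]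
    rw [thetaDeg_grMk _ _ _ hz, thetaDeg_grMk _ _ _ hzw, hw, linearize_mul]
  · rw [thetaExt, thetaExt, dualExt_of_mem_ne _ hx h,
      dualExt_of_mem_ne _ (ι_mul_mem_symPow _ hx) (by omega)]

theorem conv_apply_one {A M : Type*} [CommRing A] [AddCommGroup M] [Module A M]
    (f g : SymConv A M) : (f * g) 1 = f 1 * g 1 := by
  rw [LinearMap.convMul_apply, Bialgebra.comul_one, Algebra.TensorProduct.one_def,
    TensorProduct.map_tmul, LinearMap.mul'_apply]

theorem thetaExt_add {n : ℕ} (P Q : ↥(diffOp k A n)) :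
    thetaExt n (P + Q) = thetaExt n P + thetaExt n Q := by
  simp [thetaExt]

theorem thetaExt_mul {i j n : ℕ} (h : i + j = n) (P : ↥(diffOp k A i)) (Q : ↥(diffOp k A j))
    (R : ↥(diffOp k A n)) (hR : (R : Module.End k A) = P * Q) :
    thetaExt n R = thetaExt i P * thetaExt j Q := by
  induction n generalizing i j with
  | zero =>
    obtain ⟨rfl, rfl⟩ : i = 0 ∧ j = 0 := by omega
    refine symConv_ext ?_ fun a x => ?_
    · rw [conv_apply_one, thetaExt_zero_one, thetaExt_zero_one, thetaExt_zero_one]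
      have := mem_diffOp_zero.1 P.2 ((Q : Module.End k A) 1) 1
      rw [mul_one] at this
      rw [mul_comm, hR]
      exact this
    · rw [← contract_apply, ← contract_apply, contract_mul, contract_thetaExt_zero,
        contract_thetaExt_zero, contract_thetaExt_zero, zero_mul, mul_zero, add_zero]
  | succ n ih =>
    refine symConv_ext ?_ fun a x => ?_
    · rw [conv_apply_one, thetaExt_succ_one]
      rcases i with _ | i
      · obtain rfl : j = n + 1 := by omega
        rw [thetaExt_succ_one, mul_zero]
      · rw [thetaExt_succ_one, zero_mul]
    · rw [← contract_apply, ← contract_apply, contract_mul, contract_thetaExt_succ]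
      congr 2
      have hb : bracket a (R : Module.End k A) =
          (bracket a (P : Module.End k A) * Q + P * bracket a (Q : Module.End k A) : Module.End k A) := by
        rw [hR, bracket_mul]
      rcases i with _ | i
      · obtain rfl : j = n + 1 := by omega
        rw [contract_thetaExt_zero a P, zero_mul, zero_add, contract_thetaExt_succ]
        refine ih (zero_add n) _ _ _ ?_
        have h0 : bracket a (P : Module.End k A) = 0 := mem_diffOp_iff.1 P.2 a
        rw [h0, zero_mul, zero_add] at hb
        exact hb
      rcases j with _ | j
      · obtain rfl : i = n := by omega
        rw [contract_thetaExt_zero a Q, mul_zero, add_zero, contract_thetaExt_succ]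
        refine ih (add_zero i) _ _ _ ?_
        have h0 : bracket a (Q : Module.End k A) = 0 := mem_diffOp_iff.1 Q.2 a
        rw [h0, mul_zero, add_zero] at hb
        exact hb
      · have h1 : i + (j + 1) = n := by omega
        have h2 : i + 1 + j = n := by omega
        rw [contract_thetaExt_succ, contract_thetaExt_succ,
          ← ih h1 _ _ ⟨_, h1 ▸ mul_mem_diffOp (mem_diffOp_succ.1 P.2 a) Q.2⟩ rfl,
          ← ih h2 _ _ ⟨_, h2 ▸ mul_mem_diffOp P.2 (mem_diffOp_succ.1 Q.2 a)⟩ rfl,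
          ← thetaExt_add]
        exact congrArg (thetaExt n) (Subtype.ext hb)

theorem thetaDeg_one :
    thetaDeg k A 0 GradedMonoid.GOne.one = (shuffleOne : SymDualPiece A Ω[A⁄k] 0) := by
  refine dualExt_injective 0 (Eq.trans ?_ dualExt_shuffleOne.symm)
  have h1 : (1 : Module.End k A) ∈ diffOp k A 0 :=
    IsGrCommutative.one_mem (G := diffOpLT k A)
  change thetaExt 0 ⟨1, h1⟩ = 1
  refine symConv_ext ?_ fun a x => ?_
  · rw [thetaExt_zero_one]; simp
  · rw [← contract_apply, contract_thetaExt_zero]; simp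

theorem thetaDeg_mul {i j : ℕ} (x : GrDiffPiece k A i) (y : GrDiffPiece k A j) :
    thetaDeg k A (i + j) (GradedMonoid.GMul.mul x y) =
      shuffle (thetaDeg k A i x) (thetaDeg k A j y) := by
  obtain ⟨P, rfl⟩ := grDiffMk_surjective _ x
  obtain ⟨Q, rfl⟩ := grDiffMk_surjective _ y
  refine dualExt_injective (i + j) (Eq.trans ?_ (dualExt_shuffle _ _).symm)
  exact thetaExt_mul rfl P Q ⟨(P * Q : Module.End k A), mul_mem_diffOp P.2 Q.2⟩ rfl

variable (k A) in
/-- The homomorphism `θ = ⨁ θ_n : gr Diff → (Sym Ω)^*_gr` of graded algebras. -/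
def theta : GrDiff k A →ₐ[A] SymGrDual A Ω[A⁄k] :=
  DirectSum.toAlgebra A _ (fun n => DirectSum.lof A ℕ (SymDualPiece A Ω[A⁄k]) n ∘ₗ thetaDeg k A n)
    (congrArg (DirectSum.of (SymDualPiece A Ω[A⁄k]) 0) thetaDeg_one)
    (fun {i j} x y => by
      rw [LinearMap.comp_apply, thetaDeg_mul]
      exact (DirectSum.of_mul_of (A := SymDualPiece A Ω[A⁄k]) _ _).symm)

end Theta

end DiffSmooth

end

noncomputable section

open scoped TensorProduct DirectSum

namespace DiffSmooth

/-! ### Divided powers in the dual of the symmetric algebra -/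

section DualDividedPowers

variable {A M N : Type*} [CommRing A] [AddCommGroup M] [Module A M] [AddCommGroup N] [Module A N]

/-! Linearization identifies `k`-linear operators on `A` with left `A`-linear forms on `A ⊗ A`, and
bracketing with `a` becomes multiplication by `1 ⊗ a - a ⊗ 1`. So an operator has order at most `n`
exactly when its form kills `I ^ (n + 1)`, by `linearize_eq_zero` and
`mem_diffOpLT_of_linearize_eq_zero`. Injectivity of `θ` follows once `υ` is onto.

For surjectivity, projectivity of `Ω` gives a linear lift `s : Ω → I` of `I → I / I ^ 2`. It extends
to an algebra map `symToTensor s : Sym Ω → A ⊗ A` whose leading term in degree `n` is `υ_n`. As `υ`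
is bijective, this map identifies `Sym Ω` modulo degrees at least `n` with `(A ⊗ A) / I ^ n`, for
every `n`. Hence a form on `Sym^n Ω`, extended by zero to the other degrees, transports to a form on
`A ⊗ A` killing `I ^ (n + 1)`, that is, to an operator of order at most `n` (`exists_diffOp`).

For (c), a derivation `δ` is a form on `Ω` and defines an algebra map `symPoly : Sym Ω → A[t]`, `m ↦
δ(m) t`. Its coefficient forms transport to operators `D_n`. Multiplicativity of `symPoly` and
`symToTensor s` gives the Leibniz rule, so the `D_n` integrate `δ` (`iDer_eq_top`).

For (b), `θ ∘ ϑ`, read in the full dual of `Sym Ω`, is the map `Γ(Ω^*) → (Sym Ω)^*` sending `γ_n(δ)`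
to the `n`-th coefficient of `symPoly` (`grDualToConv_theta_vartheta`). For a free module of finite
rank this map takes the divided power monomials in the dual basis to the coefficient forms of
polynomials (`gammaToConv_gammaMonomial`), so it is injective and reaches every form concentrated in
one degree. A finite projective module is a retract of such a module. With (a) and (c) this gives
(b).

Identities in the convolution algebra are proved by one device: contraction with `m` is a derivation
of the product, and a form is determined by its value at `1` and its contractions. -/

/-- Contraction with an element of the module, as a linear map. -/
def contractHom (m : M) : SymConv A M →ₗ[A] SymConv A M where
  toFun := contract m
  map_add' _ _ := rfl
  map_smul' _ _ := rfl

@[simp]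
theorem contractHom_apply (m : M) (f : SymConv A M) : contractHom m f = contract m f := rfl

theorem contract_add_left (m m' : M) (f : SymConv A M) :
    contract (m + m') f = contract m f + contract m' f := by
  refine WithConv.ofConv_injective (LinearMap.ext fun x => ?_)
  change f.ofConv _ = f.ofConv _ + f.ofConv _
  rw [← map_add]
  simp [add_mul]

theorem contract_smul_left (a : A) (m : M) (f : SymConv A M) :
    contract (a • m) f = a • contract m f := by
  refine WithConv.ofConv_injective (LinearMap.ext fun x => ?_)
  change f.ofConv _ = a • f.ofConv _
  rw [← map_smul]
  simp

/-- A linear form on the symmetric algebra is determined by its value at `1` and its contractions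
with a generating family. -/
theorem conv_ext_of_span {ι : Type*} {v : ι → M} (hv : Submodule.span A (Set.range v) = ⊤)
    {f g : SymConv A M} (h1 : f 1 = g 1) (h : ∀ i, contract (v i) f = contract (v i) g) :
    f = g := by
  have hc (m : M) : contract m f = contract m g := by
    have hm : m ∈ Submodule.span A (Set.range v) := hv ▸ Submodule.mem_top
    induction hm using Submodule.span_induction with
    | mem m hm => obtain ⟨i, rfl⟩ := hm; exact h i
    | zero =>
      rw [← zero_smul A (0 : M), contract_smul_left, contract_smul_left, zero_smul, zero_smul]
    | add m m' _ _ hm hm' => rw [contract_add_left, contract_add_left, hm, hm']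
    | smul a m _ hm => rw [contract_smul_left, contract_smul_left, hm]
  have key : ∀ y x : SymmetricAlgebra A M, f.ofConv x = g.ofConv x →
      f.ofConv (y * x) = g.ofConv (y * x) := by
    intro y
    induction y using SymmetricAlgebra.induction with
    | algebraMap r => intro x hx; rw [← Algebra.smul_def, map_smul, map_smul, hx]
    | ι m => intro x _; exact congrArg (fun F : SymConv A M => F x) (hc m)
    | mul y z hy hz => intro x hx; rw [mul_assoc]; exact hy _ (hz x hx)
    | add y z hy hz => intro x hx; rw [add_mul, map_add, map_add, hy x hx, hz x hx]
  refine WithConv.ofConv_injective (LinearMap.ext fun x => ?_)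
  simpa using key x 1 h1

theorem conv_ext {f g : SymConv A M} (h1 : f 1 = g 1) (h : ∀ m, contract m f = contract m g) :
    f = g :=
  conv_ext_of_span (v := (id : M → M)) (by simp) h1 h

@[simp]
theorem contract_one (m : M) : contract m (1 : SymConv A M) = 0 := by
  refine WithConv.ofConv_injective (LinearMap.ext fun x => ?_)
  change (1 : SymConv A M) (SymmetricAlgebra.ι A M m * x) = 0
  simp

theorem contract_prod_eq_zero {ι : Type*} (s : Finset ι) (f : ι → SymConv A M) (m : M)
    (h : ∀ i ∈ s, contract m (f i) = 0) : contract m (∏ i ∈ s, f i) = 0 := by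
  classical
  induction s using Finset.induction_on with
  | empty => simp
  | insert i s hi ih =>
    rw [Finset.prod_insert hi, contract_mul, h i (Finset.mem_insert_self i s),
      ih fun j hj => h j (Finset.mem_insert_of_mem hj), zero_mul, mul_zero, add_zero]

theorem conv_sum_apply {κ : Type*} (s : Finset κ) (F : κ → SymConv A M)
    (x : SymmetricAlgebra A M) : (∑ i ∈ s, F i) x = ∑ i ∈ s, F i x := by
  classical
  induction s using Finset.induction_on with
  | empty => rfl
  | insert i s hi ih => rw [Finset.sum_insert hi, Finset.sum_insert hi, ← ih]; rfl

/-- The homomorphism `Sym M → A[t]` which sends `m` to `δ(m) t`. -/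
def symPoly (δ : Module.Dual A M) : SymmetricAlgebra A M →ₐ[A] Polynomial A :=
  SymmetricAlgebra.lift (Polynomial.monomial 1 ∘ₗ δ)

theorem symPoly_ι (δ : Module.Dual A M) (m : M) :
    symPoly δ (SymmetricAlgebra.ι A M m) = Polynomial.monomial 1 (δ m) := by
  rw [symPoly, SymmetricAlgebra.lift_ι_apply]; rfl

/-- The `n`-th divided power of a linear form `δ` on `M`: the form on `Sym M` with
`m₁ ⋯ mₙ ↦ δ(m₁) ⋯ δ(mₙ)` in degree `n` and zero in the other degrees. -/
def dualDp (n : ℕ) (δ : Module.Dual A M) : SymConv A M :=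
  WithConv.toConv (Polynomial.lcoeff A n ∘ₗ (symPoly δ).toLinearMap)

theorem dualDp_apply (n : ℕ) (δ : Module.Dual A M) (x : SymmetricAlgebra A M) :
    dualDp n δ x = (symPoly δ x).coeff n := rfl

theorem dualDp_zero_one (δ : Module.Dual A M) : dualDp 0 δ 1 = 1 := by
  simp [dualDp_apply]

theorem dualDp_succ_one (n : ℕ) (δ : Module.Dual A M) : dualDp (n + 1) δ 1 = 0 := by
  simp [dualDp_apply, Polynomial.coeff_one]

theorem contract_dualDp_zero (m : M) (δ : Module.Dual A M) : contract m (dualDp 0 δ) = 0 := by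
  refine WithConv.ofConv_injective (LinearMap.ext fun x => ?_)
  change (symPoly δ (SymmetricAlgebra.ι A M m * x)).coeff 0 = 0
  rw [map_mul, symPoly_ι, Polynomial.mul_coeff_zero, Polynomial.coeff_monomial]
  simp

/-- Together with the value at `1` this recursion determines the divided powers. Their rules for
scalars, products and sums are deduced from it by induction on the degree. -/
theorem contract_dualDp_succ (m : M) (n : ℕ) (δ : Module.Dual A M) :
    contract m (dualDp (n + 1) δ) = δ m • dualDp n δ := by
  refine WithConv.ofConv_injective (LinearMap.ext fun x => ?_)
  change (symPoly δ (SymmetricAlgebra.ι A M m * x)).coeff (n + 1) = δ m • (symPoly δ x).coeff n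
  rw [map_mul, symPoly_ι, ← Polynomial.C_mul_X_eq_monomial, mul_assoc, Polynomial.coeff_C_mul,
    Polynomial.coeff_X_mul, smul_eq_mul]

theorem dualDp_zero (δ : Module.Dual A M) : dualDp 0 δ = 1 :=
  conv_ext (by rw [dualDp_zero_one]; simp) fun m => by rw [contract_dualDp_zero, contract_one]

theorem dualDp_smul (n : ℕ) (a : A) (δ : Module.Dual A M) :
    dualDp n (a • δ) = a ^ n • dualDp n δ := by
  induction n with
  | zero => rw [dualDp_zero, dualDp_zero, pow_zero, one_smul]
  | succ n ih =>
    refine conv_ext ?_ fun m => ?_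
    · change _ = a ^ (n + 1) • dualDp (n + 1) δ 1
      rw [dualDp_succ_one, dualDp_succ_one, smul_zero]
    · rw [← contractHom_apply m (_ • _), map_smul, contractHom_apply, contract_dualDp_succ,
        contract_dualDp_succ, ih, smul_smul, smul_smul, LinearMap.smul_apply, smul_eq_mul]
      congr 1
      ring

/-- Contracting both sides with `m` produces the factor `δ m` and reduces the claim to Pascal's
rule. -/
theorem dualDp_mul (r s : ℕ) (δ : Module.Dual A M) :
    dualDp r δ * dualDp s δ = (r + s).choose r • dualDp (r + s) δ := by
  induction hn : r + s generalizing r s with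
  | zero =>
    obtain ⟨rfl, rfl⟩ : r = 0 ∧ s = 0 := by omega
    simp [dualDp_zero]
  | succ n ih =>
    rcases r with _ | r
    · obtain rfl : s = n + 1 := by omega
      simp [dualDp_zero]
    rcases s with _ | s
    · obtain rfl : r = n := by omega
      simp [dualDp_zero]
    refine conv_ext ?_ fun m => ?_
    · change _ = (n + 1).choose (r + 1) • dualDp (n + 1) δ 1
      have h := dualDp_succ_one n δ
      rw [conv_apply_one, dualDp_succ_one, h, zero_mul, smul_zero]
    · rw [← contractHom_apply m (_ • _), map_nsmul, contractHom_apply, contract_mul,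
        contract_dualDp_succ, contract_dualDp_succ, contract_dualDp_succ, smul_mul_assoc,
        mul_smul_comm, ih r (s + 1) (by omega), ih (r + 1) s (by omega), ← smul_add, ← add_smul,
        Nat.choose_succ_succ, smul_comm]

theorem dualDp_add (n : ℕ) (δ δ' : Module.Dual A M) :
    dualDp n (δ + δ') =
      ∑ p ∈ Finset.HasAntidiagonal.antidiagonal n, dualDp p.1 δ * dualDp p.2 δ' := by
  induction n with
  | zero => simp [dualDp_zero]
  | succ n ih =>
    refine conv_ext ?_ fun m => ?_
    · rw [dualDp_succ_one]
      symm
      rw [conv_sum_apply]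
      refine Finset.sum_eq_zero fun p hp => ?_
      have := Finset.HasAntidiagonal.mem_antidiagonal.1 hp
      obtain ⟨i, j⟩ := p
      rcases i with _ | i
      · obtain rfl : j = n + 1 := by simpa using this
        rw [conv_apply_one, dualDp_succ_one, mul_zero]
      · rw [conv_apply_one, dualDp_succ_one, zero_mul]
    · rw [contract_dualDp_succ, ← contractHom_apply m (∑ p ∈ _, _), map_sum]
      simp only [contractHom_apply, contract_mul, Finset.sum_add_distrib]
      -- The term with first index `0` leaves the first sum and the term with second index `0`
      -- leaves the second, since the contraction of a zeroth divided power vanishes. What remains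
      -- is `δ m` and `δ' m` times the sum in degree `n`.
      rw [Finset.Nat.sum_antidiagonal_succ, Finset.Nat.sum_antidiagonal_succ']
      simp only [contract_dualDp_zero, contract_dualDp_succ, zero_mul, mul_zero, zero_add,
        smul_mul_assoc, mul_smul_comm, ← Finset.smul_sum, ← ih]
      rw [← add_smul, LinearMap.add_apply]

variable (A M) in
/-- The homomorphism from the divided power algebra of `M^*` to the dual of `Sym M`. -/
def gammaToConv : DividedPowerAlgebra A (Module.Dual A M) →ₐ[A] SymConv A M :=
  DividedPowerAlgebra.lift' (f := fun p : ℕ × Module.Dual A M => dualDp p.1 p.2)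
    (fun δ => dualDp_zero δ) (fun n a δ => dualDp_smul n a δ) (fun r s δ => dualDp_mul r s δ)
    (fun n δ δ' => dualDp_add n δ δ')

@[simp]
theorem gammaToConv_dp (n : ℕ) (δ : Module.Dual A M) :
    gammaToConv A M (DividedPowerAlgebra.dp A n δ) = dualDp n δ :=
  DividedPowerAlgebra.lift'_apply_dp ..

/-! ### Functoriality in the module -/

/-- The homomorphism of symmetric algebras induced by a linear map. -/
def symMap (p : N →ₗ[A] M) : SymmetricAlgebra A N →ₐ[A] SymmetricAlgebra A M :=
  SymmetricAlgebra.lift (SymmetricAlgebra.ι A M ∘ₗ p)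

theorem symMap_ι (p : N →ₗ[A] M) (n : N) :
    symMap p (SymmetricAlgebra.ι A N n) = SymmetricAlgebra.ι A M (p n) := by
  rw [symMap, SymmetricAlgebra.lift_ι_apply]; rfl

theorem symMap_comp {L : Type*} [AddCommGroup L] [Module A L] (p : N →ₗ[A] M) (q : L →ₗ[A] N) :
    (symMap p).comp (symMap q) = symMap (p ∘ₗ q) := by
  refine SymmetricAlgebra.algHom_ext (LinearMap.ext fun x => ?_)
  simp [symMap_ι]

theorem symMap_id : symMap (LinearMap.id : M →ₗ[A] M) = AlgHom.id A _ := by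
  refine SymmetricAlgebra.algHom_ext (LinearMap.ext fun x => ?_)
  simp [symMap_ι]

theorem symMap_mem {n : ℕ} (p : N →ₗ[A] M) {x : SymmetricAlgebra A N} (hx : x ∈ symPow A N n) :
    symMap p x ∈ symPow A M n := by
  have h : (symPow A N n).map (symMap p).toLinearMap ≤ symPow A M n := by
    unfold symPow
    rw [Submodule.map_pow]
    refine pow_le_pow_left' ?_ n
    rintro _ ⟨_, ⟨y, rfl⟩, rfl⟩
    exact ⟨p y, (symMap_ι p y).symm⟩
  exact h ⟨x, hx, rfl⟩

/-- Both sides are algebra homomorphisms in `x`, and they agree on degree one because its elements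
are primitive. This is what makes pullback of forms multiplicative for the convolution. -/
theorem comul_symMap (p : N →ₗ[A] M) (x : SymmetricAlgebra A N) :
    Coalgebra.comul (R := A) (symMap p x) =
      Algebra.TensorProduct.map (symMap p) (symMap p) (Coalgebra.comul (R := A) x) := by
  have h : (Bialgebra.comulAlgHom A (SymmetricAlgebra A M)).comp (symMap p) =
      (Algebra.TensorProduct.map (symMap p) (symMap p)).comp
        (Bialgebra.comulAlgHom A (SymmetricAlgebra A N)) := by
    refine SymmetricAlgebra.algHom_ext (LinearMap.ext fun x => ?_)
    simp [symMap_ι, SymmetricAlgebra.comul_ι]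
  exact DFunLike.congr_fun h x

/-- Pullback of linear forms along `Sym N → Sym M`. -/
def convComap (p : N →ₗ[A] M) : SymConv A M →ₗ[A] SymConv A N where
  toFun f := WithConv.toConv (f.ofConv ∘ₗ (symMap p).toLinearMap)
  map_add' _ _ := rfl
  map_smul' _ _ := rfl

theorem convComap_apply (p : N →ₗ[A] M) (f : SymConv A M) (x : SymmetricAlgebra A N) :
    convComap p f x = f (symMap p x) := rfl

theorem convComap_mul (p : N →ₗ[A] M) (f g : SymConv A M) :
    convComap p (f * g) = convComap p f * convComap p g := by
  refine WithConv.ofConv_injective (LinearMap.ext fun x => ?_)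
  change (f * g) (symMap p x) = (convComap p f * convComap p g) x
  rw [LinearMap.convMul_apply, LinearMap.convMul_apply, comul_symMap]
  generalize Coalgebra.comul (R := A) x = z
  induction z with
  | zero => simp
  | add x y hx hy => simp only [map_add, hx, hy]
  | tmul x y => rfl

theorem convComap_one (p : N →ₗ[A] M) : convComap p (1 : SymConv A M) = 1 := by
  refine conv_ext ?_ fun n => ?_
  · rw [convComap_apply, map_one]; simp
  · rw [contract_one]
    refine WithConv.ofConv_injective (LinearMap.ext fun x => ?_)
    change (1 : SymConv A M) (symMap p (SymmetricAlgebra.ι A N n * x)) = 0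
    rw [map_mul, symMap_ι]
    simp

theorem convComap_dualDp (p : N →ₗ[A] M) (n : ℕ) (δ : Module.Dual A M) :
    convComap p (dualDp n δ) = dualDp n (p.dualMap δ) := by
  refine WithConv.ofConv_injective (LinearMap.ext fun x => ?_)
  change (symPoly δ (symMap p x)).coeff n = (symPoly (p.dualMap δ) x).coeff n
  have h : (symPoly δ).comp (symMap p) = symPoly (p.dualMap δ) :=
    SymmetricAlgebra.algHom_ext (LinearMap.ext fun x => by simp [symMap_ι, symPoly_ι])
  rw [← h]; rfl

/-- Naturality in the module, needed to pass from free modules to their retracts. -/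
theorem gammaToConv_map (p : N →ₗ[A] M) (x : DividedPowerAlgebra A (Module.Dual A M)) :
    gammaToConv A N (DividedPowerAlgebra.map A p.dualMap x) =
      convComap p (gammaToConv A M x) := by
  induction x using DividedPowerAlgebra.induction_on with
  | C a =>
    rw [AlgHom.commutes, AlgHom.commutes, AlgHom.commutes, Algebra.algebraMap_eq_smul_one,
      Algebra.algebraMap_eq_smul_one, map_smul, convComap_one]
  | add x y hx hy => simp only [map_add, hx, hy]
  | dp x n δ hx =>
    rw [map_mul, map_mul, map_mul, hx, convComap_mul, DividedPowerAlgebra.map_apply_dp,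
      gammaToConv_dp, gammaToConv_dp, convComap_dualDp]

/-! ### Free modules: divided power monomials and coefficient forms -/

section Free

variable {ι : Type*} (b : Module.Basis ι A M)

/-- The linear form on `Sym M` which maps a polynomial in the elements of a basis to its
coefficient at `α`. -/
def coeffForm (α : ι →₀ ℕ) : SymConv A M :=
  WithConv.toConv (MvPolynomial.lcoeff A α ∘ₗ
    (SymmetricAlgebra.equivMvPolynomial b).toLinearMap)

theorem coeffForm_apply (α : ι →₀ ℕ) (x : SymmetricAlgebra A M) :
    coeffForm b α x = (SymmetricAlgebra.equivMvPolynomial b x).coeff α := rfl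

/-- Contraction with `b i` is precomposition with multiplication by the variable `X i`, which shifts
exponents by one. -/
theorem contract_coeffForm [DecidableEq ι] (i : ι) (α : ι →₀ ℕ) :
    contract (b i) (coeffForm b α) =
      if i ∈ α.support then coeffForm b (α - Finsupp.single i 1) else 0 := by
  refine WithConv.ofConv_injective (LinearMap.ext fun x => ?_)
  change (SymmetricAlgebra.equivMvPolynomial b (SymmetricAlgebra.ι A M (b i) * x)).coeff α = _
  rw [map_mul, SymmetricAlgebra.equivMvPolynomial_ι_apply, MvPolynomial.coeff_X_mul']
  split_ifs <;> rfl

/-- The monomials in the divided powers of the dual basis. -/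
def gammaMonomial (α : ι →₀ ℕ) : DividedPowerAlgebra A (Module.Dual A M) :=
  α.prod fun i n => DividedPowerAlgebra.dp A n (b.coord i)

theorem gammaMonomial_eq (i : ι) (α : ι →₀ ℕ) :
    gammaMonomial b α = DividedPowerAlgebra.dp A (α i) (b.coord i) * gammaMonomial b (α.erase i) :=
  (Finsupp.mul_prod_erase' α i _ fun _ => DividedPowerAlgebra.dp_zero).symm

/-- Each remaining factor is a divided power of some `b.coord j` with `j ≠ i`, which vanishes at `b
i`. So contraction with `b i` only touches the `i`-th factor of a monomial. -/
theorem contract_gammaMonomial_erase (i : ι) (α : ι →₀ ℕ) :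
    contract (b i) (gammaToConv A M (gammaMonomial b (α.erase i))) = 0 := by
  rw [gammaMonomial, Finsupp.prod, map_prod]
  refine contract_prod_eq_zero _ _ _ fun j hj => ?_
  have hij : j ≠ i := by
    rintro rfl
    simp at hj
  rw [gammaToConv_dp]
  rcases α.erase i j with _ | n
  · exact contract_dualDp_zero _ _
  · rw [contract_dualDp_succ, Module.Basis.coord_apply, b.repr_self, Finsupp.single_eq_of_ne hij,
      zero_smul]

/-- Both families obey the same recursion: contraction with `b i` lowers the `i`-th exponent by one,
or gives zero if that exponent is `0`. At `1` both are `1` for `α = 0` and `0` otherwise. The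
induction is on the total degree of `α`. -/
theorem gammaToConv_gammaMonomial (α : ι →₀ ℕ) :
    gammaToConv A M (gammaMonomial b α) = coeffForm b α := by
  classical
  induction hn : α.degree using Nat.strong_induction_on generalizing α with
  | _ n ih =>
    refine conv_ext_of_span b.span_eq ?_ fun i => ?_
    · rw [coeffForm_apply, map_one (SymmetricAlgebra.equivMvPolynomial b), MvPolynomial.coeff_one]
      split_ifs with h
      · subst h
        simp [gammaMonomial]
      · obtain ⟨i, hi⟩ := Finsupp.ne_iff.1 (Ne.symm h)
        obtain ⟨l, hl⟩ := Nat.exists_eq_succ_of_ne_zero hi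
        rw [gammaMonomial_eq b i, map_mul, conv_apply_one, gammaToConv_dp, hl, dualDp_succ_one,
          zero_mul]
    · rw [gammaMonomial_eq b i, map_mul, contract_mul, contract_gammaMonomial_erase, mul_zero,
        add_zero, gammaToConv_dp, contract_coeffForm]
      split_ifs with h
      · obtain ⟨l, hl⟩ := Nat.exists_eq_succ_of_ne_zero (Finsupp.mem_support_iff.1 h)
        have hle : Finsupp.single i 1 ≤ α := by
          rw [Finsupp.single_le_iff]; omega
        have hdeg : (α - Finsupp.single i 1).degree < n := by
          have h1 := congrArg Finsupp.degree (tsub_add_cancel_of_le hle)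
          rw [map_add, Finsupp.degree_single] at h1
          omega
        rw [← ih _ hdeg _ rfl, gammaMonomial_eq b i (α - _), map_mul, gammaToConv_dp, hl,
          contract_dualDp_succ]
        have he : (α - Finsupp.single i 1).erase i = α.erase i := by
          ext j
          by_cases hj : j = i
          · subst hj; simp
          · simp [Finsupp.erase_ne hj, Finsupp.single_eq_of_ne hj]
        rw [he]
        simp [hl]
      · rw [Finsupp.notMem_support_iff.1 h, contract_dualDp_zero, zero_mul]

/-- The monomial with exponent `α` in the elements of a basis. -/
def symMonomial (α : ι →₀ ℕ) : SymmetricAlgebra A M :=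
  (SymmetricAlgebra.equivMvPolynomial b).symm (MvPolynomial.monomial α 1)

theorem coeffForm_symMonomial [DecidableEq ι] (α β : ι →₀ ℕ) :
    coeffForm b α (symMonomial b β) = if β = α then 1 else 0 := by
  rw [coeffForm_apply, symMonomial, AlgEquiv.apply_symm_apply, MvPolynomial.coeff_monomial]

theorem symMonomial_mem (α : ι →₀ ℕ) : symMonomial b α ∈ symPow A M α.degree := by
  rw [symMonomial, MvPolynomial.monomial_eq, map_one, one_mul, Finsupp.prod, map_prod]
  simp only [map_pow, SymmetricAlgebra.equivMvPolynomial_symm_X]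
  rw [Finsupp.degree_apply]
  refine SetLike.prod_mem_graded (symPow A M) _ _ fun i _ => ?_
  have := SetLike.pow_mem_graded (A := symPow A M) (α i) (ι_mem_symPow (A := A) (b i))
  simpa using this

theorem conv_ext_symMonomial {f g : SymConv A M}
    (h : ∀ α, f (symMonomial b α) = g (symMonomial b α)) : f = g := by
  refine WithConv.ofConv_injective (LinearMap.ext fun x => ?_)
  obtain ⟨x, rfl⟩ := (SymmetricAlgebra.equivMvPolynomial b).symm.surjective x
  have : f.ofConv ∘ₗ (SymmetricAlgebra.equivMvPolynomial b).symm.toLinearMap =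
      g.ofConv ∘ₗ (SymmetricAlgebra.equivMvPolynomial b).symm.toLinearMap :=
    MvPolynomial.linearMap_ext fun α => LinearMap.ext_ring (h α)
  exact DFunLike.congr_fun this x

/-- Finiteness makes the coordinate forms span the dual, so the divided power monomials span
`Γ(M^*)`. Evaluating the image of a combination at the monomial of exponent `β` reads off its
coefficient at `β`. -/
theorem gammaToConv_injective_of_basis [Finite ι] (b : Module.Basis ι A M) :
    Function.Injective (gammaToConv A M) := by
  classical
  cases nonempty_fintype ι
  refine (injective_iff_map_eq_zero _).2 fun x hx => ?_
  have hspan : Submodule.span A (Set.range (b.coord : ι → Module.Dual A M)) = ⊤ := by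
    rw [← b.coe_dualBasis]; exact b.dualBasis.span_eq
  have hx' : x ∈ Submodule.span A (Set.range (gammaMonomial b)) :=
    (DividedPowerAlgebra.submodule_span_prod_dp_eq_top hspan).symm ▸ Submodule.mem_top
  obtain ⟨c, rfl⟩ := Finsupp.mem_span_range_iff_exists_finsupp.1 hx'
  have hc : c = 0 := by
    ext β
    have h := congrArg (fun F : SymConv A M => F (symMonomial b β)) hx
    rw [Finsupp.sum, map_sum] at h
    simp only [map_smul, gammaToConv_gammaMonomial, conv_sum_apply] at h
    have h' : ∑ α ∈ c.support, c α * coeffForm b α (symMonomial b β) = 0 := h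
    simpa [coeffForm_symMonomial] using h'
  rw [hc]; simp

theorem mem_range_gammaToConv_of_basis [Finite ι] (b : Module.Basis ι A M) {n : ℕ} {f : SymConv A M}
    (hf : ∀ m ≠ n, ∀ x ∈ symPow A M m, f x = 0) : ∃ z, gammaToConv A M z = f := by
  classical
  cases nonempty_fintype ι
  -- The expansion of `f` in coefficient forms: only exponents of total degree `n` contribute, and
  -- there are finitely many of them because the basis is finite.
  refine ⟨∑ α ∈ Finset.finsuppAntidiag Finset.univ n, f (symMonomial b α) • gammaMonomial b α,
    conv_ext_symMonomial b fun β => ?_⟩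
  rw [map_sum]
  simp only [map_smul, gammaToConv_gammaMonomial, conv_sum_apply]
  change ∑ α ∈ Finset.finsuppAntidiag Finset.univ n,
    f (symMonomial b α) * coeffForm b α (symMonomial b β) = _
  simp only [coeffForm_symMonomial, mul_ite, mul_one, mul_zero, Finset.sum_ite_eq]
  split_ifs with h
  · rfl
  -- An exponent outside the index set has degree different from `n`, and there `f` vanishes by
  -- assumption.
  · refine (hf β.degree (fun hβ => h ?_) _ (symMonomial_mem b β)).symm
    rw [Finset.mem_finsuppAntidiag]
    refine ⟨?_, Finset.subset_univ _⟩
    rw [← hβ, Finsupp.degree_eq_sum]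

end Free

/-! ### Finite projective modules, as retracts of free ones -/

variable [Module.Finite A M] [Module.Projective A M]

/-- Write the identity of `M` as `p ∘ i` through a free module of finite rank. Dualizing reverses
the order, so `Γ(p^*)` has the left inverse `Γ(i^*)`, and injectivity descends by naturality. -/
theorem gammaToConv_injective : Function.Injective (gammaToConv A M) := by
  obtain ⟨n, p, i, -, -, hpi⟩ := Module.Finite.exists_comp_eq_id_of_projective A M
  have h : Function.LeftInverse (DividedPowerAlgebra.map A i.dualMap)
      (DividedPowerAlgebra.map A p.dualMap) := fun x => by
    have := DividedPowerAlgebra.map_comp (R := A) p.dualMap i.dualMap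
    rw [LinearMap.dualMap_comp_dualMap, hpi, LinearMap.dualMap_id,
      DividedPowerAlgebra.map_id] at this
    exact (DFunLike.congr_fun this x).symm
  intro x y hxy
  refine h.injective (gammaToConv_injective_of_basis (Pi.basisFun A (Fin n)) ?_)
  rw [gammaToConv_map, gammaToConv_map, hxy]

/-- The form is pulled back along `p` to the free module, which keeps it in degree `n`. A preimage
found there is carried back by `Γ(i^*)`. -/
theorem mem_range_gammaToConv {n : ℕ} {f : SymConv A M}
    (hf : ∀ m ≠ n, ∀ x ∈ symPow A M m, f x = 0) : ∃ z, gammaToConv A M z = f := by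
  obtain ⟨l, p, i, -, -, hpi⟩ := Module.Finite.exists_comp_eq_id_of_projective A M
  obtain ⟨z, hz⟩ := mem_range_gammaToConv_of_basis (Pi.basisFun A (Fin l)) (f := convComap p f)
    (n := n) fun m hm x hx => hf m hm _ (symMap_mem p hx)
  refine ⟨DividedPowerAlgebra.map A i.dualMap z, ?_⟩
  rw [gammaToConv_map, hz]
  refine WithConv.ofConv_injective (LinearMap.ext fun x => ?_)
  change f ((symMap p).comp (symMap i) x) = f x
  rw [symMap_comp, hpi, symMap_id, AlgHom.id_apply]

end DualDividedPowers

/-! ### Splitting the filtration by powers of the diagonal ideal -/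

section Splitting

variable {k A : Type*} [CommRing k] [CommRing A] [Algebra k A]

theorem diagPow_antitone : Antitone (diagPow k A) := fun _ _ h _ hx => Ideal.pow_le_pow_right h hx

theorem mul_mem_diagPow {n : ℕ} {x : A ⊗[k] A} (y : A ⊗[k] A) (hx : x ∈ diagPow k A n) :
    x * y ∈ diagPow k A n :=
  Ideal.mul_mem_right y (KaehlerDifferential.ideal k A ^ n) hx

theorem one_tmul_sub_mem (a : A) : (1 ⊗ₜ a - a ⊗ₜ 1 : A ⊗[k] A) ∈ diagPow k A 1 := by
  change _ ∈ KaehlerDifferential.ideal k A ^ 1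
  rw [pow_one]
  exact KaehlerDifferential.one_smul_sub_smul_one_mem_ideal k a

/-- An operator whose linearization vanishes on `I ^ n` has order less than `n`. -/
theorem mem_diffOpLT_of_linearize_eq_zero {n : ℕ} {P : Module.End k A}
    (h : ∀ z ∈ diagPow k A n, linearize k A P z = 0) : P ∈ diffOpLT k A n := by
  induction n generalizing P with
  | zero =>
    refine (Submodule.mem_bot A).2 (LinearMap.ext fun b => ?_)
    have := h (1 ⊗ₜ b) (by simp [diagPow])
    simpa using this
  | succ n ih =>
    refine mem_diffOp_iff.2 fun a => ih fun z hz => ?_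
    -- The form of `[P, a]` at `z` is the form of `P` at `(1 ⊗ a - a ⊗ 1) z`, and this product lies
    -- one step deeper in the filtration.
    rw [← linearize_mul]
    refine h _ ?_
    rw [add_comm n 1]
    exact IsGrCommutative.mul_mem (G := fun n => diagPow k A (n + 1)) (one_tmul_sub_mem a) hz

/-- The operator `b ↦ u(1 ⊗ b)` attached to a linear form on `A ⊗ A`. -/
def toOperator (u : A ⊗[k] A →ₗ[A] A) : Module.End k A :=
  u.restrictScalars k ∘ₗ TensorProduct.mk k A A 1

/-- Operators can thus be constructed as linear forms on `A ⊗ A`. -/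
theorem linearize_toOperator (u : A ⊗[k] A →ₗ[A] A) : linearize k A (toOperator u) = u := by
  ext b
  simp [toOperator]

theorem linearize_one_tmul (P : Module.End k A) (b : A) : linearize k A P (1 ⊗ₜ b) = P b := by
  simp

/-- `υ` respects the gradings, so its bijectivity can be tested degree by degree. -/
theorem upsilon_apply_eq (n : ℕ) (x : SymmetricAlgebra A Ω[A⁄k]) :
    upsilon k A x n = upsilonDeg k A n (symProj A _ n x) := by
  have h : DirectSum.component A ℕ (GrIPiece k A) n ∘ₗ (upsilon k A).toLinearMap =
      upsilonDeg k A n ∘ₗ symProj A _ n := by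
    refine symPow_ext fun m x hx => ?_
    by_cases hmn : m = n
    · subst hmn
      rw [LinearMap.comp_apply, LinearMap.comp_apply, symProj_of_mem hx]
      rfl
    · obtain ⟨z, hz⟩ := upsilon_of_mem hx
      rw [LinearMap.comp_apply, LinearMap.comp_apply, symProj_of_mem_ne hx hmn, map_zero]
      change (upsilon k A x) n = 0
      rw [hz]
      exact DirectSum.of_eq_of_ne _ _ _ (Ne.symm hmn)
  exact DFunLike.congr_fun h x

theorem upsilonDeg_surjective (hs : Function.Surjective (upsilon k A)) (n : ℕ) :
    Function.Surjective (upsilonDeg k A n) := fun z => by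
  obtain ⟨x, hx⟩ := hs (DirectSum.of (GrIPiece k A) n z)
  refine ⟨symProj A _ n x, ?_⟩
  rw [← upsilon_apply_eq, hx]
  exact DirectSum.of_eq_same _ _

theorem upsilonDeg_injective (hs : Function.Injective (upsilon k A)) (n : ℕ) :
    Function.Injective (upsilonDeg k A n) := by
  refine (injective_iff_map_eq_zero _).2 fun x hx => ?_
  obtain ⟨z, hz⟩ := upsilon_of_mem x.2
  have h : upsilonDeg k A n x = grIMk n z := by
    change (upsilon k A x) n = _
    rw [hz]
    exact DirectSum.of_eq_same _ _
  rw [hx] at h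
  rw [← h, map_zero] at hz
  exact Subtype.ext (hs (hz.trans (map_zero _).symm))

theorem upsilonOne_D (a : A) : upsilonOne k A (KaehlerDifferential.D k A a) =
    grIMk 1 ⟨1 ⊗ₜ a - a ⊗ₜ 1, one_tmul_sub_mem a⟩ := by
  have h := upsilon_D (k := k) a
  rw [upsilon, SymmetricAlgebra.lift_ι_apply] at h
  exact DirectSum.of_injective (β := GrIPiece k A) 1 h

variable (k A) in
-- The point where projectivity of `Ω` enters parts (a) and (c). The lift is not canonical; any
-- choice serves.
theorem exists_lift_upsilonOne [Module.Projective A Ω[A⁄k]] :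
    ∃ s : Ω[A⁄k] →ₗ[A] ↥(diagPow k A 1), grIMk 1 ∘ₗ s = upsilonOne k A :=
  Module.projective_lifting_property _ _ (grMk_surjective 1)

/-- The homomorphism `Sym Ω → A ⊗ A` which extends a linear map `Ω → I`. -/
def symToTensor (s : Ω[A⁄k] →ₗ[A] ↥(diagPow k A 1)) : SymmetricAlgebra A Ω[A⁄k] →ₐ[A] A ⊗[k] A :=
  SymmetricAlgebra.lift ((diagPow k A 1).subtype ∘ₗ s)

theorem symToTensor_ι (s : Ω[A⁄k] →ₗ[A] ↥(diagPow k A 1)) (w : Ω[A⁄k]) :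
    symToTensor s (SymmetricAlgebra.ι A _ w) = s w := by
  rw [symToTensor, SymmetricAlgebra.lift_ι_apply]; rfl

variable {s : Ω[A⁄k] →ₗ[A] ↥(diagPow k A 1)}

/-- `symToTensor s` is multiplicative and lifts `υ` in degree one, so on `Sym^n Ω` it lands in `I ^
n` and its leading term is `υ_n`. -/
theorem upsilon_eq_symToTensor
    (hsec : grIMk 1 ∘ₗ s = upsilonOne k A) {n : ℕ} {x : SymmetricAlgebra A Ω[A⁄k]}
    (hx : x ∈ symPow A Ω[A⁄k] n) : ∃ z : ↥(diagPow k A n), (z : A ⊗[k] A) = symToTensor s x ∧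
      upsilon k A x = DirectSum.of (GrIPiece k A) n (grIMk n z) := by
  unfold symPow at hx
  induction hx using Submodule.pow_induction_on_left' with
  | algebraMap r =>
    refine ⟨r • ⟨1, IsGrCommutative.one_mem (G := fun n => diagPow k A (n + 1))⟩, ?_, ?_⟩
    · rw [AlgHom.commutes, Algebra.algebraMap_eq_smul_one]; rfl
    · rw [AlgHom.commutes]; rfl
  | add x y i hx hy ihx ihy =>
    obtain ⟨z, hz', hz⟩ := ihx
    obtain ⟨w, hw', hw⟩ := ihy
    exact ⟨z + w, by rw [map_add, ← hz', ← hw']; rfl, by rw [map_add, hz, hw, ← map_add, ← map_add]⟩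
  | mem_mul m hm i x hx ih =>
    obtain ⟨m, rfl⟩ := hm
    obtain ⟨z, hz', hz⟩ := ih
    obtain ⟨w, hw', hw⟩ := of_mul_of_grIMk (s m) z
    refine ⟨w, ?_, ?_⟩
    · rw [hw', map_mul, symToTensor_ι, hz']
    · rw [map_mul, hz, ← hw, upsilon, SymmetricAlgebra.lift_ι_apply, LinearMap.comp_apply, ← hsec]
      rfl

theorem symToTensor_mem
    (hsec : grIMk 1 ∘ₗ s = upsilonOne k A) {n : ℕ} {x : SymmetricAlgebra A Ω[A⁄k]}
    (hx : x ∈ symPow A Ω[A⁄k] n) : symToTensor s x ∈ diagPow k A n := by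
  obtain ⟨z, hz, -⟩ := upsilon_eq_symToTensor hsec hx
  exact hz ▸ z.2

theorem upsilonDeg_eq_symToTensor
    (hsec : grIMk 1 ∘ₗ s = upsilonOne k A) {n : ℕ} (x : ↥(symPow A Ω[A⁄k] n)) :
    upsilonDeg k A n x = grIMk n ⟨symToTensor s x, symToTensor_mem hsec x.2⟩ := by
  obtain ⟨z, hz, hz'⟩ := upsilon_eq_symToTensor hsec x.2
  obtain rfl : z = ⟨symToTensor s x, symToTensor_mem hsec x.2⟩ := Subtype.ext hz
  change (upsilon k A x) n = _
  rw [hz']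
  exact DirectSum.of_eq_same _ _

/-- Successive approximation: an error in `I ^ n` is corrected modulo `I ^ (n + 1)` by an element of
degree `n`, since `υ_n` is onto. -/
theorem exists_sub_symToTensor_mem
    (hsec : grIMk 1 ∘ₗ s = upsilonOne k A) (hs : Function.Surjective (upsilon k A)) (n : ℕ)
    (b : A ⊗[k] A) : ∃ x, b - symToTensor s x ∈ diagPow k A n := by
  induction n with
  | zero => exact ⟨0, by simp [diagPow]⟩
  | succ n ih =>
    obtain ⟨x, hx⟩ := ih
    obtain ⟨y, hy⟩ := upsilonDeg_surjective hs n (grIMk n ⟨_, hx⟩)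
    rw [upsilonDeg_eq_symToTensor hsec] at hy
    refine ⟨x + y, ?_⟩
    rw [map_add, ← sub_sub]
    exact grMk_eq_iff.1 hy.symm

theorem symToTensor_mem_of_symProj_eq_zero
    (hsec : grIMk 1 ∘ₗ s = upsilonOne k A) {n : ℕ} {x : SymmetricAlgebra A Ω[A⁄k]}
    (hx : ∀ m < n, symProj A _ m x = 0) : symToTensor s x ∈ diagPow k A n := by
  classical
  rw [← DirectSum.sum_support_decompose (symPow A Ω[A⁄k]) x, map_sum]
  refine sum_mem fun m hm => ?_
  have hmn : n ≤ m := by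
    by_contra h
    exact (DFinsupp.mem_support_iff.1 hm) (hx m (by omega))
  exact diagPow_antitone hmn (symToTensor_mem hsec (SetLike.coe_mem _))

/-- If all components below degree `m` vanish, the class of the image in `I ^ m / I ^ (m + 1)` is
`υ_m` of the component of degree `m`. When that class is zero, injectivity of `υ_m` kills the
component. -/
theorem symProj_eq_zero_of_symToTensor_mem
    (hsec : grIMk 1 ∘ₗ s = upsilonOne k A) (hs : Function.Injective (upsilon k A)) {n : ℕ}
    {x : SymmetricAlgebra A Ω[A⁄k]} (hx : symToTensor s x ∈ diagPow k A n) :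
    ∀ m < n, symProj A _ m x = 0 := by
  induction n with
  | zero => intro m hm; omega
  | succ n ih =>
    have h := ih (diagPow_antitone (Nat.le_succ n) hx)
    intro m hm
    rcases Nat.lt_succ_iff_lt_or_eq.1 hm with hm | rfl
    · exact h m hm
    · refine upsilonDeg_injective hs m ?_
      rw [map_zero, upsilonDeg_eq_symToTensor hsec, grMk_eq_zero]
      -- After removal of the component of degree `m` only higher degrees are left, and these map
      -- into `I ^ (m + 1)`.
      have h1 : symToTensor s (x - symProj A _ m x) ∈ diagPow k A (m + 1) := by
        refine symToTensor_mem_of_symProj_eq_zero hsec fun l hl => ?_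
        rw [map_sub]
        rcases Nat.lt_succ_iff_lt_or_eq.1 hl with hl | rfl
        · rw [h l hl, symProj_of_mem_ne (SetLike.coe_mem _) (by omega), sub_zero]
        · rw [symProj_of_mem (SetLike.coe_mem _), sub_self]
      rw [map_sub] at h1
      simpa using sub_mem hx h1

/-- The composite `Sym Ω → (A ⊗ A) / I ^ n` is onto, so a form that kills its kernel descends to the
quotient. -/
theorem exists_linearMap_comp_symToTensor
    (hsec : grIMk 1 ∘ₗ s = upsilonOne k A) (hs : Function.Surjective (upsilon k A)) (n : ℕ)
    (f : SymmetricAlgebra A Ω[A⁄k] →ₗ[A] A)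
    (hf : ∀ x, symToTensor s x ∈ diagPow k A n → f x = 0) :
    ∃ u : A ⊗[k] A →ₗ[A] A, (∀ x, u (symToTensor s x) = f x) ∧ ∀ z ∈ diagPow k A n, u z = 0 := by
  let g := (diagPow k A n).mkQ ∘ₗ (symToTensor s).toLinearMap
  have hg : Function.Surjective g := fun y => by
    obtain ⟨b, rfl⟩ := Submodule.mkQ_surjective _ y
    obtain ⟨x, hx⟩ := exists_sub_symToTensor_mem hsec hs n b
    exact ⟨x, ((Submodule.Quotient.eq _).2 hx).symm⟩
  have hk : LinearMap.ker g ≤ LinearMap.ker f := fun x hx =>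
    hf x ((Submodule.Quotient.mk_eq_zero _).1 hx)
  refine ⟨(LinearMap.ker g).liftQ f hk ∘ₗ (g.quotKerEquivOfSurjective hg).symm.toLinearMap ∘ₗ
    (diagPow k A n).mkQ, fun x => ?_, fun z hz => ?_⟩
  · have : (g.quotKerEquivOfSurjective hg).symm ((diagPow k A n).mkQ (symToTensor s x)) =
        (LinearMap.ker g).mkQ x := by
      rw [LinearEquiv.symm_apply_eq]; rfl
    rw [LinearMap.comp_apply, LinearMap.comp_apply, LinearEquiv.coe_coe, this]
    rfl
  · have : (diagPow k A n).mkQ z = 0 := (Submodule.Quotient.mk_eq_zero _).2 hz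
    rw [LinearMap.comp_apply, LinearMap.comp_apply, this, map_zero, map_zero]

/-- Every linear form on `Sym^n Ω` comes from a differential operator of order at most `n`. -/
theorem exists_diffOp
    (hsec : grIMk 1 ∘ₗ s = upsilonOne k A) (hs : Function.Bijective (upsilon k A)) (n : ℕ)
    (u : SymDualPiece A Ω[A⁄k] n) : ∃ P : ↥(diffOp k A n),
      ∀ x, linearize k A P (symToTensor s x) = dualExt n u x := by
  -- The exponent is `n + 1` because an element mapping into `I ^ (n + 1)` has no component in
  -- degree `n`, the only one that the form sees.
  obtain ⟨v, hv, hv'⟩ := exists_linearMap_comp_symToTensor hsec hs.2 (n + 1) (dualExt n u).ofConv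
    fun x hx => by
      have h := symProj_eq_zero_of_symToTensor_mem hsec hs.1 hx n (Nat.lt_succ_self n)
      exact (congrArg u h).trans (map_zero u)
  -- Order less than `n + 1` is order at most `n` by definition.
  refine ⟨⟨toOperator v, mem_diffOpLT_of_linearize_eq_zero (n := n + 1) fun z hz => ?_⟩,
    fun x => ?_⟩
  · rw [linearize_toOperator]; exact hv' z hz
  · exact (DFunLike.congr_fun (linearize_toOperator v) _).trans (hv x)

end Splitting

/-! ### Bijectivity of `θ` -/

section ThetaBijective

variable {k A : Type*} [CommRing k] [CommRing A] [Algebra k A]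

theorem thetaDeg_injective (hs : Function.Surjective (upsilon k A)) (n : ℕ) :
    Function.Injective (thetaDeg k A n) := by
  refine (injective_iff_map_eq_zero _).2 fun y hy => ?_
  obtain ⟨P, rfl⟩ := grDiffMk_surjective n y
  refine grMk_eq_zero.2 (mem_diffOpLT_of_linearize_eq_zero fun z hz => ?_)
  -- Every class in `I ^ n / I ^ (n + 1)` is `υ_n x`, so vanishing of `θ_n` forces the linearization
  -- to vanish on all of `I ^ n`.
  obtain ⟨x, hx⟩ := upsilonDeg_surjective hs n (grIMk n ⟨z, hz⟩)
  have h := thetaDeg_grMk P x _ hx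
  rw [hy] at h
  exact h.symm

theorem thetaDeg_surjective [Module.Projective A Ω[A⁄k]]
    (hs : Function.Bijective (upsilon k A)) (n : ℕ) : Function.Surjective (thetaDeg k A n) := by
  intro u
  obtain ⟨s, hsec⟩ := exists_lift_upsilonOne k A
  obtain ⟨P, hP⟩ := exists_diffOp hsec hs n u
  refine ⟨grDiffMk n P, LinearMap.ext fun x => ?_⟩
  rw [thetaDeg_grMk P x _ (upsilonDeg_eq_symToTensor hsec x), hP]
  exact dualExt_of_mem u x.2

theorem theta_of (n : ℕ) (x : GrDiffPiece k A n) :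
    theta k A (DirectSum.of (GrDiffPiece k A) n x) =
      DirectSum.of (SymDualPiece A Ω[A⁄k]) n (thetaDeg k A n x) :=
  DirectSum.toAddMonoid_of
    (fun n => (DirectSum.lof A ℕ (SymDualPiece A Ω[A⁄k]) n ∘ₗ thetaDeg k A n).toAddMonoidHom) n x

theorem theta_apply (x : GrDiff k A) (n : ℕ) : theta k A x n = thetaDeg k A n (x n) := by
  induction x using DirectSum.induction_on with
  | zero => rw [map_zero, DirectSum.zero_apply, DirectSum.zero_apply, map_zero]
  | of m x =>
    rw [theta_of]
    by_cases h : m = n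
    · subst h
      rw [DirectSum.of_eq_same, DirectSum.of_eq_same]
    · rw [DirectSum.of_eq_of_ne _ _ _ (Ne.symm h), DirectSum.of_eq_of_ne _ _ _ (Ne.symm h),
        map_zero]
  | add x y hx hy => rw [map_add, DirectSum.add_apply, DirectSum.add_apply, hx, hy, map_add]

theorem theta_bijective [Module.Projective A Ω[A⁄k]] (hs : Function.Bijective (upsilon k A)) :
    Function.Bijective (theta k A) := by
  refine ⟨(injective_iff_map_eq_zero _).2 fun x hx => ?_, fun y => ?_⟩
  · refine DFinsupp.ext fun n => thetaDeg_injective hs.2 n ?_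
    rw [← theta_apply, hx]
    exact (map_zero (thetaDeg k A n)).symm
  · induction y using DirectSum.induction_on with
    | zero => exact ⟨0, map_zero _⟩
    | of n u =>
      obtain ⟨x, rfl⟩ := thetaDeg_surjective hs n u
      exact ⟨_, theta_of n x⟩
    | add y z hy hz =>
      obtain ⟨x, rfl⟩ := hy
      obtain ⟨w, rfl⟩ := hz
      exact ⟨x + w, map_add _ _ _⟩

end ThetaBijective

/-! ### Integrability of derivations -/

section Integrable

variable {k A M : Type*} [CommRing k] [CommRing A] [Algebra k A] [AddCommGroup M] [Module A M]

theorem symPoly_of_mem (δ : Module.Dual A M) {n : ℕ} {x : SymmetricAlgebra A M}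
    (hx : x ∈ symPow A M n) : ∃ a, symPoly δ x = Polynomial.monomial n a := by
  unfold symPow at hx
  induction hx using Submodule.pow_induction_on_left' with
  | algebraMap r => exact ⟨r, by rw [AlgHom.commutes]; rfl⟩
  | add x y i hx hy ihx ihy =>
    obtain ⟨a, ha⟩ := ihx
    obtain ⟨b, hb⟩ := ihy
    exact ⟨a + b, by rw [map_add, ha, hb, map_add]⟩
  | mem_mul m hm i x hx ih =>
    obtain ⟨m, rfl⟩ := hm
    obtain ⟨a, ha⟩ := ih
    exact ⟨δ m * a, by rw [map_mul, ha, symPoly_ι, Polynomial.monomial_mul_monomial, add_comm]⟩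

theorem dualDp_of_mem_ne (δ : Module.Dual A M) {m n : ℕ} (h : m ≠ n) {x : SymmetricAlgebra A M}
    (hx : x ∈ symPow A M m) : dualDp n δ x = 0 := by
  obtain ⟨a, ha⟩ := symPoly_of_mem δ hx
  rw [dualDp_apply, ha, Polynomial.coeff_monomial, if_neg h]

/-- The components are the operators whose forms, composed with `symToTensor s`, are the
coefficients of `symPoly`. They come from one algebra map to `A[t]`, and the product of polynomials
becomes the Leibniz rule. -/
theorem iDer_eq_top [Module.Projective A Ω[A⁄k]] (hs : Function.Bijective (upsilon k A)) :
    IDer k A = ⊤ := by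
  refine eq_top_iff.2 fun δ _ => ?_
  obtain ⟨s, hsec⟩ := exists_lift_upsilonOne k A
  have hD (n : ℕ) : ∃ P : ↥(diffOp k A n), ∀ x, linearize k A P (symToTensor s x) =
      dualDp n δ.liftKaehlerDifferential x := by
    obtain ⟨P, hP⟩ := exists_diffOp hsec hs n (dualRes n (dualDp n δ.liftKaehlerDifferential))
    refine ⟨P, fun x => ?_⟩
    rw [hP, dualExt_dualRes fun m hm x hx => dualDp_of_mem_ne _ hm hx]
  choose D hD using hD
  -- The form of `D m` kills `I ^ (m + 1)`, which contains `I ^ (n + 1)`, so it may be computed on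
  -- any approximation of `z` from `Sym Ω` modulo `I ^ (n + 1)`.
  have hval {n m : ℕ} (hmn : m ≤ n) (x : SymmetricAlgebra A Ω[A⁄k]) (z : A ⊗[k] A)
      (hz : z - symToTensor s x ∈ diagPow k A (n + 1)) :
      linearize k A (D m) z = (symPoly δ.liftKaehlerDifferential x).coeff m := by
    have h0 : linearize k A (D m) (z - symToTensor s x) = 0 :=
      linearize_eq_zero (n := m + 1) (D m).2 (diagPow_antitone (by omega) hz)
    rw [map_sub, sub_eq_zero] at h0
    rw [h0, hD, dualDp_apply]
  refine ⟨⟨fun n => D n, ?_, fun n x y => ?_⟩, ?_⟩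
  · refine LinearMap.ext fun a => ?_
    -- Modulo `I`, the element `1 ⊗ a` is the scalar `a ⊗ 1`.
    rw [← linearize_one_tmul, hval (n := 0) le_rfl (algebraMap A _ a)]
    · rw [AlgHom.commutes]; simp
    · rw [AlgHom.commutes]; exact one_tmul_sub_mem a
  · obtain ⟨X, hX⟩ := exists_sub_symToTensor_mem hsec hs.2 (n + 1) (1 ⊗ₜ x)
    obtain ⟨Y, hY⟩ := exists_sub_symToTensor_mem hsec hs.2 (n + 1) (1 ⊗ₜ y)
    -- The product of approximations of `1 ⊗ x` and `1 ⊗ y` approximates `1 ⊗ (x * y)`, as `I ^ (n +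
    -- 1)` is an ideal. The same `X` and `Y` serve for all components up to degree `n`.
    rw [← linearize_one_tmul, hval le_rfl (X * Y), map_mul, Polynomial.coeff_mul]
    · refine Finset.sum_congr rfl fun p hp => ?_
      have := Finset.HasAntidiagonal.mem_antidiagonal.1 hp
      rw [← linearize_one_tmul, ← linearize_one_tmul (D p.2 : Module.End k A),
        hval (n := n) (by omega) X _ hX, hval (n := n) (by omega) Y _ hY]
    · have h : (1 ⊗ₜ (x * y) - symToTensor s (X * Y) : A ⊗[k] A) =
          (1 ⊗ₜ x - symToTensor s X) * (1 ⊗ₜ y) + (1 ⊗ₜ y - symToTensor s Y) * symToTensor s X := by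
        have h1 : (1 ⊗ₜ (x * y) : A ⊗[k] A) = (1 ⊗ₜ x) * (1 ⊗ₜ y) := by
          rw [Algebra.TensorProduct.tmul_mul_tmul, one_mul]
        rw [map_mul, h1]
        ring
      rw [h]
      exact add_mem (mul_mem_diagPow _ hX) (mul_mem_diagPow _ hY)
  · refine LinearMap.ext fun a => ?_
    change (D 1 : Module.End k A) a = δ a
    -- Modulo `I ^ 2`, `1 ⊗ a` is `a ⊗ 1 + s(da)`, because `s` lifts the class of `1 ⊗ a - a ⊗ 1`.
    rw [← linearize_one_tmul, hval (n := 1) le_rfl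
      (algebraMap A _ a + SymmetricAlgebra.ι A _ (KaehlerDifferential.D k A a))]
    · rw [map_add, AlgHom.commutes, symPoly_ι, Derivation.liftKaehlerDifferential_comp_D]
      simp [Polynomial.algebraMap_eq]
    · rw [map_add, AlgHom.commutes, symToTensor_ι, ← sub_sub]
      have h := DFunLike.congr_fun hsec (KaehlerDifferential.D k A a)
      rw [upsilonOne_D] at h
      exact grMk_eq_iff.1 h.symm

end Integrable

/-! ### The divided power algebra of the integrable derivations -/

section VarthetaBijective

variable {k A M : Type*} [CommRing k] [CommRing A] [Algebra k A] [AddCommGroup M] [Module A M]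

variable (A M) in
/-- The embedding of the graded dual of `Sym M` into its dual. -/
def grDualToConv : SymGrDual A M →ₐ[A] SymConv A M :=
  DirectSum.toAlgebra A _ (fun n => dualExt n) dualExt_shuffleOne
    (fun u v => dualExt_shuffle u v)

theorem grDualToConv_of (n : ℕ) (u : SymDualPiece A M n) :
    grDualToConv A M (DirectSum.of (SymDualPiece A M) n u) = dualExt n u :=
  DirectSum.toAddMonoid_of (fun n => (dualExt n).toAddMonoidHom) n u

theorem dualRes_grDualToConv (y : SymGrDual A M) (n : ℕ) :
    dualRes n (grDualToConv A M y) = y n := by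
  induction y using DirectSum.induction_on with
  | zero => rw [map_zero, map_zero, DirectSum.zero_apply]
  | of m u =>
    rw [grDualToConv_of]
    by_cases h : m = n
    · subst h
      rw [dualRes_dualExt, DirectSum.of_eq_same]
    · rw [DirectSum.of_eq_of_ne _ _ _ (Ne.symm h)]
      exact LinearMap.ext fun x => dualExt_of_mem_ne u x.2 (Ne.symm h)
  | add x y hx hy => rw [map_add, map_add, DirectSum.add_apply, hx, hy]

theorem grDualToConv_injective : Function.Injective (grDualToConv A M) := fun x y h =>
  DFinsupp.ext fun n => by rw [← dualRes_grDualToConv, h, dualRes_grDualToConv]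

theorem exists_gammaToConv_eq [Module.Finite A M] [Module.Projective A M] (y : SymGrDual A M) :
    ∃ z, gammaToConv A M z = grDualToConv A M y := by
  induction y using DirectSum.induction_on with
  | zero => exact ⟨0, by rw [map_zero, map_zero]⟩
  | of n u =>
    rw [grDualToConv_of]
    exact mem_range_gammaToConv fun m hm x hx => dualExt_of_mem_ne u hx hm
  | add x y hx hy =>
    obtain ⟨z, hz⟩ := hx
    obtain ⟨w, hw⟩ := hy
    exact ⟨z + w, by rw [map_add, map_add, hz, hw]⟩

variable (k A) in
/-- The linear form on `Ω` attached to an integrable derivation. -/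
def iDerToDual : IDer k A →ₗ[A] Module.Dual A Ω[A⁄k] :=
  (KaehlerDifferential.linearMapEquivDerivation k A).symm.toLinearMap ∘ₗ (IDer k A).subtype

theorem iDerToDual_D (δ : IDer k A) (a : A) :
    iDerToDual k A δ (KaehlerDifferential.D k A a) = (δ : Derivation k A A) a :=
  Derivation.liftKaehlerDifferential_comp_D (δ : Derivation k A A) a

theorem thetaExt_eq_of_sub_mem {n : ℕ} {P Q : ↥(diffOp k A n)}
    (h : (P : Module.End k A) - Q ∈ diffOpLT k A n) : thetaExt n P = thetaExt n Q :=
  congrArg (fun x => dualExt n (thetaDeg k A n x)) (grMk_eq_iff.2 h)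

theorem thetaExt_smul {n : ℕ} (a : A) (P : ↥(diffOp k A n)) :
    thetaExt n (a • P) = a • thetaExt n P := by
  simp [thetaExt]

/-- Contraction with `da` replaces `D_(n+1)` by `[D_(n+1), a]`, which is `δ(a) D_n` up to lower
order. This is the recursion satisfied by the divided powers of the form of `δ`. -/
theorem thetaExt_hasseSchmidt (D : HasseSchmidt k A) (δ : IDer k A)
    (hD : D.toFun 1 = ((δ : Derivation k A A) : Module.End k A)) (n : ℕ) :
    thetaExt n ⟨D.toFun n, D.mem_diffOp n⟩ = dualDp n (iDerToDual k A δ) := by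
  induction n with
  | zero =>
    refine symConv_ext ?_ fun a x => ?_
    · rw [thetaExt_zero_one, dualDp_zero_one]
      exact DFunLike.congr_fun D.map_zero 1
    · rw [← contract_apply, ← contract_apply, contract_thetaExt_zero, contract_dualDp_zero]
  | succ n ih =>
    refine symConv_ext ?_ fun a x => ?_
    · rw [thetaExt_succ_one, dualDp_succ_one]
    · rw [← contract_apply, ← contract_apply, contract_thetaExt_succ, contract_dualDp_succ, ← ih,
        iDerToDual_D, ← thetaExt_smul]
      congr 2
      refine thetaExt_eq_of_sub_mem ?_
      have h := D.bracket_sub_mem n a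
      rw [hD] at h
      exact h

/-- Both sides are algebra homomorphisms, so it suffices to compare them on the divided powers of
one derivation. The identity reduces the study of `ϑ` to the pairing between `Γ(Ω^*)` and `Sym Ω`.
-/
theorem grDualToConv_theta_vartheta (x : DividedPowerAlgebra A (IDer k A)) :
    grDualToConv A _ (theta k A (vartheta k A x)) =
      gammaToConv A _ (DividedPowerAlgebra.map A (iDerToDual k A) x) := by
  have h : ((grDualToConv A Ω[A⁄k]).comp (theta k A)).comp (vartheta k A) =
      (gammaToConv A _).comp (DividedPowerAlgebra.map A (iDerToDual k A)) := by
    refine DividedPowerAlgebra.algHom_ext fun n δ => ?_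
    obtain ⟨D, hD⟩ := δ.2
    have hv : vartheta k A (DividedPowerAlgebra.dp A n δ) = chi n δ :=
      DividedPowerAlgebra.lift'_apply_dp ..
    rw [AlgHom.comp_apply, AlgHom.comp_apply, AlgHom.comp_apply, hv,
      DividedPowerAlgebra.map_apply_dp, gammaToConv_dp, chi_eq n δ D hD,
      ← thetaExt_hasseSchmidt D δ hD]
    exact (congrArg _ (theta_of n _)).trans (grDualToConv_of n _)
  exact DFunLike.congr_fun h x

theorem vartheta_bijective [Module.Finite A Ω[A⁄k]] [Module.Projective A Ω[A⁄k]]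
    (hs : Function.Bijective (upsilon k A)) : Function.Bijective (vartheta k A) := by
  -- Since every derivation is integrable, the module of integrable derivations is all of `Ω^*`.
  have hmap : Function.Bijective (DividedPowerAlgebra.map A (iDerToDual k A)) :=
    (DividedPowerAlgebra.mapEquiv ((LinearEquiv.ofTop _ (iDer_eq_top hs)).trans
      (KaehlerDifferential.linearMapEquivDerivation k A).symm)).bijective
  refine ⟨fun x y hxy => ?_, fun y => ?_⟩
  · refine hmap.1 (gammaToConv_injective ?_)
    rw [← grDualToConv_theta_vartheta, hxy, grDualToConv_theta_vartheta]
  -- The image of `y` in the dual of `Sym Ω` comes from some `x`; injectivity of `θ` and of the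
  -- embedding of the graded dual then gives `ϑ x = y`.
  · obtain ⟨z, hz⟩ := exists_gammaToConv_eq (theta k A y)
    obtain ⟨x, rfl⟩ := hmap.2 z
    rw [← grDualToConv_theta_vartheta] at hz
    exact ⟨x, (theta_bijective hs).1 (grDualToConv_injective hz)⟩

end VarthetaBijective

end DiffSmooth

end

theorem mainTheorem6 (k A : Type*) [CommRing k] [CommRing A] [Algebra k A]
    [Module.Finite A Ω[A⁄k]] [Module.Projective A Ω[A⁄k]]
    (hsmooth : Function.Bijective (DiffSmooth.upsilon k A)) :
    Function.Bijective (DiffSmooth.theta k A) ∧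
      Function.Bijective (DiffSmooth.vartheta k A) ∧
      DiffSmooth.IDer k A = ⊤ :=
  ⟨DiffSmooth.theta_bijective hsmooth, DiffSmooth.vartheta_bijective hsmooth,
    DiffSmooth.iDer_eq_top hsmooth⟩
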